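/- Let $k$ be a field, $G$ a group, and $\mathcal C$ a small $k$-linear category on which $G$ acts by $k$-linear automorphisms, the action on the objects being free. Write ${}_y\mathcal C_x$ for the morphisms from $x$ to $y$. Let $\mathcal C/G$ be the quotient category: its objects are the orbits, its morphisms from $\alpha$ to $\beta$ are the coinvariants $\bigl(\bigoplus_{x\in\alpha,\,y\in\beta}{}_y\mathcal C_x\bigr)_G$, and the composite of the classes of $f\in{}_y\mathcal C_x$ and $g\in{}_z\mathcal C_{sy}$ ($s\in G$) is the class of $g\circ(sf)$. Let $\pi:\mathcal C\to\mathcal C/G$ be the projection (the Galois covering). For a $k$-category $\mathcal B$, let $C^n(\mathcal B)=\prod_{x_{n+1},\dots,x_1}\mathrm{Hom}_k({}_{x_{n+1}}\mathcal B_{x_n}\otimes\cdots\otimes{}_{x_2}\mathcal B_{x_1},\,{}_{x_{n+1}}\mathcal B_{x_1})$ (so $C^0(\mathcal B)=\prod_x{}_x\mathcal B_x$), with the coboundary $$(d\varphi)(f_{n+1}\otimes\cdots\otimes f_1)=(-1)^{n+1}f_{n+1}\varphi(f_n\otimes\cdots\otimes f_1)+\sum_{i=1}^n(-1)^i\varphi(f_{n+1}\otimes\cdots\otimes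 f_{i+1}f_i\otimes\cdots\otimes f_1)+\varphi(f_{n+1}\otimes\cdots\otimes f_2)f_1 ,$$ let $HH^*(\mathcal B)=H^*(C^\bullet(\mathcal B))$ be the Hochschild-Mitchell cohomology, with the cup product induced by $(\psi\smile\varphi)(f_{n+m}\otimes\cdots\otimes f_1)=\psi(f_{n+m}\otimes\cdots\otimes f_{n+1})\,\varphi(f_n\otimes\cdots\otimes f_1)$. The group $G$ acts on $C^\bullet(\mathcal C)$ and on $HH^*(\mathcal C)$ by $(s\varphi)(f_n\otimes\cdots\otimes f_1)=s\,\varphi(s^{-1}f_n\otimes\cdots\otimes s^{-1}f_1)$. If $\mathcal B$ is $G$-graded and $D$ is a conjugacy class of $G$, let $C_D^n(\mathcal B)$ be the space of cochains $\varphi$ such that, for all $f_i$ homogeneous of degree $s_i$, $\varphi(f_n\otimes\cdots\otimes f_1)$ is a sum of homogeneous morphisms of degrees $s_0$ with $s_n\cdots s_1s_0^{-1}\in D$, and let $HH_D^*(\mathcal B)$ be the cohomology of $C_D^\bullet(\mathcal B)$. A transversal $(u_\alpha)_\alpha$ of the action of $G$ on the objects of $\mathcal C$ determines a $G$-grading of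 $\mathcal C/G$: the morphisms of degree $s$ from $\alpha$ to $\beta$ are the classes of the elements of ${}_{u_\beta}\mathcal C_{su_\alpha}$. Suppose that the invariants functor $M\mapsto M^G$ on $kG$-modules is exact. Then every class in $HH^n(\mathcal C)^G$ is represented by an invariant cocycle; every invariant cocycle $\varphi$ of $\mathcal C$ has an invariant cohomology class and induces a unique cochain $\bar\varphi$ of $\mathcal C/G$ with $\bar\varphi(\pi f_n\otimes\cdots\otimes\pi f_1)=\pi(\varphi(f_n\otimes\cdots\otimes f_1))$ for all composable $f_n,\dots,f_1$ in $\mathcal C$, and $\bar\varphi$ is a cocycle; and $[\varphi]\mapsto[\bar\varphi]$ is a well-defined injective $k$-linear morphism $$\iota: HH^*(\mathcal C)^G\hookrightarrow HH^*(\mathcal C/G)$$ of graded $k$-algebras, which has a $k$-linear retraction $\rho$ ($\rho\circ\iota=\mathrm{id}$) in each degree. Moreover, for every transversal, the grading above is indeed a $G$-grading of $\mathcal C/G$, the inclusions of complexes give a decomposition $HH^*(\mathcal C/G)=\prod_D HH_D^*(\mathcal C/G)$ over the conjugacy classes $D$ of $G$, the image of $\iota$ is the factor $HH^*_{\{1\}}(\mathcal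 C/G)$ of the trivial conjugacy class, and $\iota\circ\rho$ is the projection of the product to that factor. -/

import Mathlib

open CategoryTheory

attribute [local instance 2000] CategoryTheory.CategoryStruct.toQuiver

universe w u v t

set_option linter.unusedSectionVars false

namespace HochschildMitchell

section Cochains

/-- The composite `x a ⟶ x b` (for `a ≤ b`) of a sequence of composable morphisms
`f i : x i ⟶ x (i + 1)`. -/
noncomputable def arrow {C : Type u} [Category.{v} C] {n : ℕ} (x : Fin (n + 1) → C)
    (f : ∀ i : Fin n, x i.castSucc ⟶ x i.succ) {a b : Fin (n + 1)} (h : a ≤ b) : x a ⟶ x b :=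
  (ComposableArrows.mkOfObjOfMapSucc x f).map (homOfLE h)

variable {C : Type u} [Category.{v} C]

theorem arrow_self {n : ℕ} (x : Fin (n + 1) → C)
    (f : ∀ i : Fin n, x i.castSucc ⟶ x i.succ) (a : Fin (n + 1)) :
    arrow x f (le_refl a) = 𝟙 (x a) :=
  (ComposableArrows.mkOfObjOfMapSucc x f).map_id a

theorem arrow_comp {n : ℕ} (x : Fin (n + 1) → C)
    (f : ∀ i : Fin n, x i.castSucc ⟶ x i.succ) {a b c : Fin (n + 1)} (h : a ≤ b) (h' : b ≤ c) :
    arrow x f h ≫ arrow x f h' = arrow x f (h.trans h') :=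
  ((ComposableArrows.mkOfObjOfMapSucc x f).map_comp (homOfLE h) (homOfLE h')).symm

theorem arrow_succ {n : ℕ} (x : Fin (n + 1) → C)
    (f : ∀ i : Fin n, x i.castSucc ⟶ x i.succ) (i : Fin n) :
    arrow x f i.castSucc_lt_succ.le = f i :=
  ComposableArrows.mkOfObjOfMapSucc_map_succ x f i.1 i.2

theorem arrow_congr {n : ℕ} (x : Fin (n + 1) → C)
    (f g : ∀ i : Fin n, x i.castSucc ⟶ x i.succ) {a : Fin (n + 1)} :
    ∀ {b : Fin (n + 1)} (h : a ≤ b),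
      (∀ p : Fin n, a ≤ p.castSucc → p.succ ≤ b → f p = g p) → arrow x f h = arrow x g h := by
  intro b
  induction b using Fin.induction with
  | zero =>
    intro h _
    obtain rfl : a = 0 := Fin.le_zero_iff.1 h
    rw [arrow_self, arrow_self]
  | succ j ih =>
    intro h H
    rcases eq_or_lt_of_le h with rfl | h'
    · rw [arrow_self, arrow_self]
    · have h1 : a ≤ j.castSucc := Fin.le_castSucc_iff.2 h'
      rw [← arrow_comp x f h1 j.castSucc_lt_succ.le, ← arrow_comp x g h1 j.castSucc_lt_succ.le,
        arrow_succ, arrow_succ, H j h1 le_rfl,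
        ih h1 (fun p hp hp' => H p hp (hp'.trans j.castSucc_lt_succ.le))]

theorem arrow_update_of_notMem {n : ℕ} (x : Fin (n + 1) → C)
    (f : ∀ i : Fin n, x i.castSucc ⟶ x i.succ) [DecidableEq (Fin n)] (p : Fin n)
    (v : x p.castSucc ⟶ x p.succ)
    {a b : Fin (n + 1)} (h : a ≤ b) (H : b ≤ p.castSucc ∨ p.succ ≤ a) :
    arrow x (Function.update f p v) h = arrow x f h := by
  apply arrow_congr
  intro q hq hq'
  apply Function.update_of_ne
  rintro rfl
  rcases H with H | H
  · exact absurd (hq'.trans H) (not_le.2 q.castSucc_lt_succ)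
  · exact absurd (H.trans hq) (not_le.2 q.castSucc_lt_succ)

theorem arrow_update_of_mem {n : ℕ} (x : Fin (n + 1) → C)
    (f : ∀ i : Fin n, x i.castSucc ⟶ x i.succ) [DecidableEq (Fin n)] (p : Fin n)
    (v : x p.castSucc ⟶ x p.succ)
    {a b : Fin (n + 1)} (h : a ≤ b) (h1 : a ≤ p.castSucc) (h2 : p.succ ≤ b) :
    arrow x (Function.update f p v) h = arrow x f h1 ≫ v ≫ arrow x f h2 := by
  rw [← arrow_comp x _ (h1.trans p.castSucc_lt_succ.le) h2,
    ← arrow_comp x _ h1 p.castSucc_lt_succ.le, arrow_succ,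
    arrow_update_of_notMem _ _ _ _ _ (Or.inl le_rfl),
    arrow_update_of_notMem _ _ _ _ _ (Or.inr le_rfl), Function.update_self, Category.assoc]

theorem arrow_map {D : Type*} [Category D] (F : C ⥤ D) {n : ℕ} (x : Fin (n + 1) → C)
    (f : ∀ i : Fin n, x i.castSucc ⟶ x i.succ) {a : Fin (n + 1)} :
    ∀ {b : Fin (n + 1)} (h : a ≤ b),
      F.map (arrow x f h) = arrow (fun i => F.obj (x i)) (fun i => F.map (f i)) h := by
  intro b
  induction b using Fin.induction with
  | zero =>
    intro h
    obtain rfl : a = 0 := Fin.le_zero_iff.1 h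
    rw [arrow_self, arrow_self, F.map_id]
  | succ j ih =>
    intro h
    rcases eq_or_lt_of_le h with rfl | h'
    · rw [arrow_self, arrow_self, F.map_id]
    · have h1 : a ≤ j.castSucc := Fin.le_castSucc_iff.2 h'
      rw [← arrow_comp x f h1 j.castSucc_lt_succ.le,
        ← arrow_comp _ _ h1 j.castSucc_lt_succ.le, F.map_comp, ih h1, arrow_succ, arrow_succ]

theorem exists_block {m n : ℕ} (θ : Fin (m + 1) →o Fin (n + 1)) (p : Fin n)
    (h0 : ¬ p.succ ≤ θ 0) (h1 : ¬ θ (Fin.last m) ≤ p.castSucc) :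
    ∃ j : Fin m, θ j.castSucc ≤ p.castSucc ∧ p.succ ≤ θ j.succ := by
  by_contra! H
  have key : ∀ i : Fin (m + 1), θ i ≤ p.castSucc := by
    intro i
    induction i using Fin.induction with
    | zero => exact Fin.le_castSucc_iff.2 (not_le.1 h0)
    | succ j ih => exact Fin.le_castSucc_iff.2 (H j ih)
  exact h1 (key _)

variable (k : Type w) [CommRing k] [Preadditive C] [Linear k C]

variable (C) in
/-- Hochschild-Mitchell cochains of degree `n`: families, indexed by the sequences `x` of `n + 1`
objects, of `k`-multilinear maps
`Hom (x 0, x 1) × ⋯ × Hom (x (n - 1), x n) → Hom (x 0, x n)`. For `n = 0` this is the product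
over all objects of the endomorphism spaces. -/
abbrev Cochain (n : ℕ) : Type max u v :=
  ∀ x : Fin (n + 1) → C,
    MultilinearMap k (fun i : Fin n => (x i.castSucc ⟶ x i.succ)) (x 0 ⟶ x (Fin.last n))

variable {k}

/-- The value of `coface`: compose the given sequence along `θ`, apply `φ`, and compose with the
initial and final morphisms which are left out by `θ`. -/
noncomputable def cofaceFun {m n : ℕ} (θ : Fin (m + 1) →o Fin (n + 1)) (φ : Cochain C k m)
    (x : Fin (n + 1) → C) (f : ∀ i : Fin n, x i.castSucc ⟶ x i.succ) : x 0 ⟶ x (Fin.last n) :=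
  arrow x f (Fin.zero_le (θ 0)) ≫
    φ (fun i => x (θ i)) (fun j => arrow x f (θ.monotone j.castSucc_lt_succ.le)) ≫
      arrow x f (Fin.le_last (θ (Fin.last m)))

theorem cofaceFun_update {m n : ℕ} (θ : Fin (m + 1) →o Fin (n + 1)) (φ : Cochain C k m)
    (x : Fin (n + 1) → C) (f : ∀ i : Fin n, x i.castSucc ⟶ x i.succ) [DecidableEq (Fin n)]
    (p : Fin n) :
    ∃ T : (x p.castSucc ⟶ x p.succ) →ₗ[k] (x 0 ⟶ x (Fin.last n)),
      ∀ v, cofaceFun θ φ x (Function.update f p v) = T v := by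
  have mono : ∀ {i j : Fin (m + 1)}, i ≤ j → θ i ≤ θ j := fun h => θ.monotone h
  by_cases h0 : p.succ ≤ θ 0
  · refine ⟨Linear.rightComp k _ (φ (fun i => x (θ i))
        (fun j => arrow x f (θ.monotone j.castSucc_lt_succ.le)) ≫
      arrow x f (Fin.le_last (θ (Fin.last m)))) ∘ₗ
      Linear.leftComp k _ (arrow x f (Fin.zero_le p.castSucc)) ∘ₗ
      Linear.rightComp k _ (arrow x f h0), fun v => ?_⟩
    simp only [cofaceFun, LinearMap.comp_apply, Linear.rightComp_apply, Linear.leftComp_apply]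
    rw [arrow_update_of_mem x f p v (Fin.zero_le (θ 0)) (Fin.zero_le p.castSucc) h0,
      arrow_update_of_notMem x f p v (Fin.le_last _)
        (Or.inr (h0.trans (mono (Fin.zero_le _))))]
    congr! 4
    exact arrow_update_of_notMem x f p v _ (Or.inr (h0.trans (mono (Fin.zero_le _))))
  by_cases h1 : θ (Fin.last m) ≤ p.castSucc
  · refine ⟨Linear.leftComp k _ (arrow x f (Fin.zero_le (θ 0)) ≫ φ (fun i => x (θ i))
        (fun j => arrow x f (θ.monotone j.castSucc_lt_succ.le)) ≫ arrow x f h1) ∘ₗ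
      Linear.rightComp k _ (arrow x f (Fin.le_last p.succ)), fun v => ?_⟩
    simp only [cofaceFun, LinearMap.comp_apply, Linear.rightComp_apply, Linear.leftComp_apply,
      Category.assoc]
    rw [arrow_update_of_mem x f p v (Fin.le_last _) h1 (Fin.le_last _),
      arrow_update_of_notMem x f p v (Fin.zero_le _)
        (Or.inl ((mono (Fin.le_last _)).trans h1))]
    congr! 4
    exact arrow_update_of_notMem x f p v _ (Or.inl ((mono (Fin.le_last _)).trans h1))
  obtain ⟨j, hj, hj'⟩ := exists_block θ p h0 h1
  refine ⟨Linear.leftComp k _ (arrow x f (Fin.zero_le (θ 0))) ∘ₗ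
    Linear.rightComp k _ (arrow x f (Fin.le_last (θ (Fin.last m)))) ∘ₗ
    (φ (fun i => x (θ i))).toLinearMap
        (fun j => arrow x f (θ.monotone j.castSucc_lt_succ.le)) j ∘ₗ
    Linear.leftComp k _ (arrow x f hj) ∘ₗ Linear.rightComp k _ (arrow x f hj'), fun v => ?_⟩
  simp only [cofaceFun, LinearMap.comp_apply, Linear.rightComp_apply, Linear.leftComp_apply,
    MultilinearMap.toLinearMap_apply]
  rw [arrow_update_of_notMem x f p v (Fin.le_last _) (Or.inr (hj'.trans (mono (Fin.le_last _)))),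
    arrow_update_of_notMem x f p v (Fin.zero_le _) (Or.inl ((mono (Fin.zero_le _)).trans hj))]
  congr! 3
  rw [Function.eq_update_iff]
  refine ⟨arrow_update_of_mem x f p v _ hj hj', fun i hi => arrow_update_of_notMem x f p v _ ?_⟩
  rcases lt_or_gt_of_ne hi with hi | hi
  · exact Or.inl ((mono (Fin.succ_le_castSucc_iff.2 hi)).trans hj)
  · exact Or.inr (hj'.trans (mono (Fin.succ_le_castSucc_iff.2 hi)))

/-- The operation on cochains induced by a monotone map `θ`. -/
noncomputable def coface {m n : ℕ} (θ : Fin (m + 1) →o Fin (n + 1)) :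
    Cochain C k m →ₗ[k] Cochain C k n where
  toFun φ x :=
    { toFun := cofaceFun θ φ x
      map_update_add' := fun f p v v' => by
        obtain ⟨T, hT⟩ := cofaceFun_update θ φ x f p
        rw [hT, hT, hT, map_add]
      map_update_smul' := fun f p c v => by
        obtain ⟨T, hT⟩ := cofaceFun_update θ φ x f p
        rw [hT, hT, map_smul] }
  map_add' φ ψ := by
    ext x f
    simp [cofaceFun]
  map_smul' c φ := by
    ext x f
    simp [cofaceFun]

/-- The Hochschild-Mitchell coboundary `d φ = ∑ i, (-1) ^ i • φ ∘ ∂ᵢ`. On a composable sequence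
`f₁, …, f_{n+1}` (with `fᵢ : x (i - 1) ⟶ x i`) the map `Fin.succAbove i` skips the object `x i`, so
that the term with `i = 0` is `φ (f_{n+1}, …, f₂) ∘ f₁`, the one with `0 < i < n + 1` is
`φ (f_{n+1}, …, f_{i+1} ∘ fᵢ, …, f₁)`, and the one with `i = n + 1` is
`f_{n+1} ∘ φ (fₙ, …, f₁)`. -/
noncomputable def d (C : Type u) [Category.{v} C] (k : Type w) [CommRing k] [Preadditive C]
    [Linear k C] (n : ℕ) : Cochain C k n →ₗ[k] Cochain C k (n + 1) :=
  ∑ i : Fin (n + 2), (-1 : k) ^ (i : ℕ) • coface (Fin.succAboveOrderEmb i).toOrderHom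

variable (C k)

theorem coface_comp {l m n : ℕ} (θ : Fin (l + 1) →o Fin (m + 1)) (θ' : Fin (m + 1) →o Fin (n + 1))
   (φ : Cochain C k l) : coface θ' (coface θ φ) = coface (θ'.comp θ) φ := by
  ext x f
  have key : ∀ {a b : Fin (m+1)} (h : a ≤ b), arrow (fun i => x (θ' i)) (fun j => arrow x f (θ'.monotone j.castSucc_lt_succ.le)) h = arrow x f (θ'.monotone h) := by
    intro a b h
    induction b using Fin.induction with
    | zero =>
      obtain rfl : a = 0 := Fin.le_zero_iff.1 h
      rw [arrow_self, arrow_self]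
    | succ j ih =>
      rcases eq_or_lt_of_le h with rfl | h'
      · rw [arrow_self, arrow_self]
      · have h1 : a ≤ j.castSucc := Fin.le_castSucc_iff.2 h'
        rw [← arrow_comp _ _ h1 j.castSucc_lt_succ.le, ih h1, arrow_succ, arrow_comp]
  have lhs : coface θ' (coface θ φ) x f = cofaceFun θ' (coface θ φ) x f := rfl
  have rhs : coface (θ'.comp θ) φ x f = cofaceFun (θ'.comp θ) φ x f := rfl
  have mid : ∀ y g, coface θ φ y g = cofaceFun θ φ y g := fun _ _ => rfl
  rw [lhs, rhs]
  unfold cofaceFun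
  rw [mid]
  unfold cofaceFun
  simp only [key, Category.assoc, arrow_comp]
  rw [← Category.assoc, arrow_comp]
  rfl

theorem coface_id (n : ℕ) (φ : Cochain C k n) : coface OrderHom.id φ = φ := by
  ext x f
  have lhs : coface OrderHom.id φ x f = cofaceFun OrderHom.id φ x f := rfl
  rw [lhs]
  unfold cofaceFun
  have : (fun j => arrow x f (OrderHom.id.monotone (Fin.castSucc_lt_succ (i := j)).le)) = f := by
    funext j; exact arrow_succ x f j
  erw [this, arrow_self, arrow_self]
  exact (Category.id_comp _).trans (Category.comp_id _)

/-- The cochains form a complex: they are the alternating complex of a cosimplicial module. -/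
theorem d_comp_d (n : ℕ) : d C k (n + 1) ∘ₗ d C k n = 0 := by
  let X : CosimplicialObject (ModuleCat.{max u v} k) :=
    { obj Δ := ModuleCat.of k (Cochain C k Δ.len)
      map θ := ModuleCat.ofHom (coface θ.toOrderHom)
      map_id Δ := by ext φ : 2; exact coface_id C k _ φ
      map_comp θ θ' := by ext φ : 2; exact (coface_comp C k _ _ φ).symm }
  have key : ∀ n, AlgebraicTopology.AlternatingCofaceMapComplex.objD X n = ModuleCat.ofHom (d C k n) := by
    intro n
    apply ModuleCat.hom_ext
    rw [AlgebraicTopology.AlternatingCofaceMapComplex.objD, ModuleCat.hom_sum]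
    refine Finset.sum_congr rfl fun i _ => ?_
    rw [ModuleCat.hom_zsmul]
    rcases Nat.even_or_odd (i : ℕ) with h | h
    · rw [h.neg_one_pow, h.neg_one_pow, one_smul, one_smul]; rfl
    · rw [h.neg_one_pow, h.neg_one_pow, neg_smul, one_smul]
      exact (neg_one_smul k (coface (C := C) (k := k) i.succAboveOrderEmb.toOrderHom)).symm
  have := AlgebraicTopology.AlternatingCofaceMapComplex.d_squared X n
  rw [key, key] at this
  exact congrArg ModuleCat.Hom.hom this

end Cochains
section Cohomology

variable (C : Type u) [Category.{v} C] (k : Type w) [CommRing k] [Preadditive C] [Linear k C]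

/-- The cocycles of degree `n`. -/
noncomputable def cocycles (n : ℕ) : Submodule k (Cochain C k n) := LinearMap.ker (d C k n)

/-- The coboundaries of degree `n`; there are none in degree `0`. -/
noncomputable def coboundaries : ∀ n : ℕ, Submodule k (Cochain C k n)
  | 0 => ⊥
  | n + 1 => LinearMap.range (d C k n)

/-- The Hochschild-Mitchell cohomology in degree `n`: cocycles modulo coboundaries. -/
abbrev HH (n : ℕ) : Type max u v :=
  cocycles C k n ⧸ (coboundaries C k n).submoduleOf (cocycles C k n)

variable {C k}

/-- The cohomology class of a cocycle. -/
noncomputable def HH.mk {n : ℕ} : cocycles C k n →ₗ[k] HH C k n :=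
  ((coboundaries C k n).submoduleOf (cocycles C k n)).mkQ

/-- The value of `cup`. -/
def cupFun {m n : ℕ} (ψ : Cochain C k m) (φ : Cochain C k n) (x : Fin (n + m + 1) → C)
    (f : ∀ i : Fin (n + m), x i.castSucc ⟶ x i.succ) : x 0 ⟶ x (Fin.last (n + m)) :=
  φ (fun i => x (Fin.castLE (by lia) i)) (fun i => f (Fin.castAdd m i)) ≫
    ψ (fun i => x (Fin.natAdd n i)) (fun i => f (Fin.natAdd n i))

theorem cupFun_update {m n : ℕ} (ψ : Cochain C k m) (φ : Cochain C k n) (x : Fin (n + m + 1) → C)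
    (f : ∀ i : Fin (n + m), x i.castSucc ⟶ x i.succ) [DecidableEq (Fin (n + m))]
    (p : Fin (n + m)) :
    ∃ T : (x p.castSucc ⟶ x p.succ) →ₗ[k] (x 0 ⟶ x (Fin.last (n + m))),
      ∀ v, cupFun ψ φ x (Function.update f p v) = T v := by
  unfold cupFun
  induction p using Fin.addCases with
  | left i =>
    refine ⟨Linear.rightComp k _
        (ψ (fun i => x (Fin.natAdd n i)) (fun i => f (Fin.natAdd n i))) ∘ₗ
      (φ (fun i => x (Fin.castLE (by lia) i))).toLinearMap (fun i => f (Fin.castAdd m i)) i,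
      fun v => ?_⟩
    have h1 : (fun j => Function.update f (Fin.castAdd m i) v (Fin.castAdd m j)) =
        Function.update (fun j => f (Fin.castAdd m j)) i v :=
      Function.update_comp_eq_of_injective' f (Fin.castAdd_injective n m) i v
    have h2 : (fun j => Function.update f (Fin.castAdd m i) v (Fin.natAdd n j)) =
        fun j => f (Fin.natAdd n j) :=
      Function.update_comp_eq_of_forall_ne' f v (fun j h => by
        have := congrArg Fin.val h
        simp at this
        lia)
    rw [h2]
    exact congrArg (fun a => a ≫ _) (congrArg _ h1)
  | right i =>
    refine ⟨Linear.leftComp k _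
        (φ (fun i => x (Fin.castLE (by lia) i)) (fun i => f (Fin.castAdd m i))) ∘ₗ
      (ψ (fun i => x (Fin.natAdd n i))).toLinearMap (fun i => f (Fin.natAdd n i)) i,
      fun v => ?_⟩
    have h1 : (fun j => Function.update f (Fin.natAdd n i) v (Fin.natAdd n j)) =
        Function.update (fun j => f (Fin.natAdd n j)) i v :=
      Function.update_comp_eq_of_injective' f (Fin.natAdd_injective m n) i v
    have h2 : (fun j => Function.update f (Fin.natAdd n i) v (Fin.castAdd m j)) =
        fun j => f (Fin.castAdd m j) :=
      Function.update_comp_eq_of_forall_ne' f v (fun j h => by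
        have := congrArg Fin.val h
        simp at this
        lia)
    rw [h2]
    exact congrArg (fun a => _ ≫ a) (congrArg _ h1)

/-- The cup product of cochains,
`(cup ψ φ) (f_{n+m}, …, f₁) = ψ (f_{n+m}, …, f_{n+1}) ∘ φ (fₙ, …, f₁)`. -/
def cup {m n : ℕ} (ψ : Cochain C k m) (φ : Cochain C k n) : Cochain C k (n + m) :=
  fun x =>
    { toFun := cupFun ψ φ x
      map_update_add' := fun f p v v' => by
        obtain ⟨T, hT⟩ := cupFun_update ψ φ x f p
        rw [hT, hT, hT, map_add]
      map_update_smul' := fun f p c v => by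
        obtain ⟨T, hT⟩ := cupFun_update ψ φ x f p
        rw [hT, hT, map_smul] }

variable (C k) in
/-- The unit cochain, of degree `0`, given by the identities of the objects. -/
noncomputable def unitCochain : Cochain C k 0 :=
  fun x => MultilinearMap.constOfIsEmpty k _ (𝟙 (x 0))

end Cohomology


section Action

/-- A strict action of a group `G` on a `k`-linear category `C` by `k`-linear isomorphisms, that
is, a group homomorphism from `G` to the group of `k`-linear automorphisms of `C`. The action on
objects is the given `MulAction G C`; a morphism `f : x ⟶ y` is sent by `s` to
`act s f : s • x ⟶ s • y`. -/
class LinearAction (k : Type w) (G : Type t) (C : Type u) [CommRing k] [Group G] [Category.{v} C]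
    [Preadditive C] [Linear k C] [MulAction G C] where
  act (s : G) {x y : C} : (x ⟶ y) →ₗ[k] (s • x ⟶ s • y)
  act_id (s : G) (x : C) : act s (𝟙 x) = 𝟙 (s • x)
  act_comp (s : G) {x y z : C} (f : x ⟶ y) (g : y ⟶ z) : act s (f ≫ g) = act s f ≫ act s g
  act_one {x y : C} (f : x ⟶ y) :
    act 1 f = eqToHom (one_smul G x) ≫ f ≫ eqToHom (one_smul G y).symm
  act_mul (s t : G) {x y : C} (f : x ⟶ y) :
    act (s * t) f = eqToHom (mul_smul s t x) ≫ act s (act t f) ≫ eqToHom (mul_smul s t y).symm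

variable {C : Type u} (k : Type w) {G : Type t} [CommRing k] [Group G] [Category.{v} C]
  [Preadditive C] [Linear k C] [MulAction G C] [LinearAction k G C]

/-- The `k`-linear map sending a morphism `f : x ⟶ y` to `s f : s x ⟶ s y`. -/
def act (s : G) {x y : C} : (x ⟶ y) →ₗ[k] (s • x ⟶ s • y) := LinearAction.act s

theorem act_id (s : G) (x : C) : act k s (𝟙 x) = 𝟙 (s • x) := LinearAction.act_id s x

theorem act_comp (s : G) {x y z : C} (f : x ⟶ y) (g : y ⟶ z) :
    act k s (f ≫ g) = act k s f ≫ act k s g := LinearAction.act_comp s f g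

theorem act_one {x y : C} (f : x ⟶ y) :
    act k (1 : G) f = eqToHom (one_smul G x) ≫ f ≫ eqToHom (one_smul G y).symm :=
  LinearAction.act_one f

theorem act_mul (s t : G) {x y : C} (f : x ⟶ y) :
    act k (s * t) f =
      eqToHom (mul_smul s t x) ≫ act k s (act k t f) ≫ eqToHom (mul_smul s t y).symm :=
  LinearAction.act_mul s t f

theorem act_eqToHom (s : G) {x y : C} (h : x = y) :
    act k s (eqToHom h) = eqToHom (congrArg (s • ·) h) := by
  subst h
  exact act_id k s x

theorem act_congr {s t : G} (h : s = t) {x y : C} (f : x ⟶ y) :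
    act k s f = eqToHom (congrArg (· • x) h) ≫ act k t f ≫
      eqToHom (congrArg (· • y) h).symm := by
  subst h
  simp

theorem act_inv_act (s : G) {x y : C} (f : x ⟶ y) :
    act k s⁻¹ (act k s f) =
      eqToHom (inv_smul_smul s x) ≫ f ≫ eqToHom (inv_smul_smul s y).symm := by
  have h1 := act_mul k s⁻¹ s f
  have h2 := act_congr k (inv_mul_cancel s) f
  rw [act_one] at h2
  rw [h2] at h1
  rw [← cancel_epi (eqToHom (mul_smul s⁻¹ s x)),
    ← cancel_mono (eqToHom (mul_smul s⁻¹ s y).symm), Category.assoc, ← h1]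
  simp

theorem act_act_inv (s : G) {x y : C} (f : x ⟶ y) :
    act k s (act k s⁻¹ f) =
      eqToHom (smul_inv_smul s x) ≫ f ≫ eqToHom (smul_inv_smul s y).symm := by
  have h1 := act_mul k s s⁻¹ f
  have h2 := act_congr k (mul_inv_cancel s) f
  rw [act_one] at h2
  rw [h2] at h1
  rw [← cancel_epi (eqToHom (mul_smul s s⁻¹ x)),
    ← cancel_mono (eqToHom (mul_smul s s⁻¹ y).symm), Category.assoc, ← h1]
  simp

variable (C) in
/-- The automorphism of `C` given by `s`. -/
def actFunctor (s : G) : C ⥤ C where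
  obj x := s • x
  map f := act k s f
  map_id x := act_id k s x
  map_comp f g := act_comp k s f g

variable {k} in
theorem cochain_congr {n : ℕ} (φ : Cochain C k n) {x x' : Fin (n + 1) → C} (h : x' = x)
    (f : ∀ i : Fin n, x i.castSucc ⟶ x i.succ) (f' : ∀ i : Fin n, x' i.castSucc ⟶ x' i.succ)
    (hf : ∀ i, f' i = eqToHom (congrFun h _) ≫ f i ≫ eqToHom (congrFun h _).symm) :
    φ x' f' = eqToHom (congrFun h _) ≫ φ x f ≫ eqToHom (congrFun h _).symm := by
  subst h
  obtain rfl : f' = f := funext fun i => by simpa using hf i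
  simp

/-- The action of `s` on cochains: `(s φ)_{x} (fₙ, …, f₁) = s (φ_{s⁻¹ x} (s⁻¹ fₙ, …, s⁻¹ f₁))`. -/
noncomputable def cochainAct (s : G) (n : ℕ) : Cochain C k n →ₗ[k] Cochain C k n where
  toFun φ x :=
    { toFun := fun f =>
        eqToHom (smul_inv_smul s (x 0)).symm ≫
          act k s (φ (fun i => s⁻¹ • x i) (fun i => act k s⁻¹ (f i))) ≫
            eqToHom (smul_inv_smul s (x (Fin.last n)))
      map_update_add' := fun f p v v' => by
        have h : ∀ v, (fun i => act k s⁻¹ (Function.update f p v i)) =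
            Function.update (fun i => act k s⁻¹ (f i)) p (act k s⁻¹ v) := fun v => by
          funext i
          exact Function.apply_update (fun i => act k s⁻¹) f p v i
        rw [h, h, h]
        simp [MultilinearMap.map_update_add]
      map_update_smul' := fun f p c v => by
        have h : ∀ v, (fun i => act k s⁻¹ (Function.update f p v i)) =
            Function.update (fun i => act k s⁻¹ (f i)) p (act k s⁻¹ v) := fun v => by
          funext i
          exact Function.apply_update (fun i => act k s⁻¹) f p v i
        rw [h, h]
        simp [MultilinearMap.map_update_smul] }
  map_add' φ ψ := by
    ext x f
    simp
  map_smul' c φ := by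
    ext x f
    simp

/-- The cochain `s φ` is characterised by `(s φ) (s fₙ, …, s f₁) = s (φ (fₙ, …, f₁))`. -/
theorem cochainAct_act (s : G) {n : ℕ} (φ : Cochain C k n) (x : Fin (n + 1) → C)
    (f : ∀ i : Fin n, x i.castSucc ⟶ x i.succ) :
    cochainAct k s n φ (fun i => s • x i) (fun i => act k s (f i)) = act k s (φ x f) := by
  change eqToHom _ ≫ act k s (φ (fun i => s⁻¹ • s • x i) (fun i => act k s⁻¹ (act k s (f i)))) ≫
    eqToHom _ = _
  rw [cochain_congr φ (x := x) (funext fun i => inv_smul_smul s (x i)) f _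
    (fun i => act_inv_act k s (f i))]
  simp only [act_comp, act_eqToHom, Category.assoc, eqToHom_trans, eqToHom_refl,
    eqToHom_trans_assoc, Category.comp_id, Category.id_comp]

theorem cochain_ext_act (s : G) {n : ℕ} {φ ψ : Cochain C k n}
    (h : ∀ (x : Fin (n + 1) → C) (f : ∀ i : Fin n, x i.castSucc ⟶ x i.succ),
      φ (fun i => s • x i) (fun i => act k s (f i)) =
        ψ (fun i => s • x i) (fun i => act k s (f i))) : φ = ψ := by
  ext x f
  have H := h (fun i => s⁻¹ • x i) (fun i => act k s⁻¹ (f i))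
  rw [cochain_congr φ (x := x) (funext fun i => smul_inv_smul s (x i)) f _
      (fun i => act_act_inv k s (f i)),
    cochain_congr ψ (x := x) (funext fun i => smul_inv_smul s (x i)) f _
      (fun i => act_act_inv k s (f i))] at H
  exact (cancel_mono _).1 ((cancel_epi _).1 H)

theorem cochainAct_coface (s : G) {m n : ℕ} (θ : Fin (m + 1) →o Fin (n + 1))
    (φ : Cochain C k m) :
    cochainAct k s n (coface θ φ) = coface θ (cochainAct k s m φ) := by
  apply cochain_ext_act k s
  intro x f
  rw [cochainAct_act]
  change act k s (cofaceFun θ φ x f) =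
    cofaceFun θ (cochainAct k s m φ) (fun i => s • x i) (fun i => act k s (f i))
  have h : ∀ {a b : Fin (n + 1)} (hab : a ≤ b),
      arrow (fun i => s • x i) (fun i => act k s (f i)) hab = act k s (arrow x f hab) :=
    fun hab => (arrow_map (actFunctor C k s) x f hab).symm
  unfold cofaceFun
  simp only [h, act_comp]
  exact congrArg (fun a => _ ≫ a ≫ _) (cochainAct_act k s φ (fun i => x (θ i)) _).symm

theorem cochainAct_d (s : G) (n : ℕ) (φ : Cochain C k n) :
    cochainAct k s (n + 1) (d C k n φ) = d C k n (cochainAct k s n φ) := by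
  simp [d, cochainAct_coface, map_sum]

variable (C) in
/-- The representation of `G` on cochains. -/
noncomputable def cochainRep (G : Type t) [Group G] [MulAction G C] [LinearAction k G C] (n : ℕ) :
    Representation k G (Cochain C k n) where
  toFun s := cochainAct k s n
  map_one' := by
    ext1 φ
    apply cochain_ext_act k (1 : G)
    intro x f
    rw [cochainAct_act, act_one]
    exact (cochain_congr φ (x := x) (funext fun i => one_smul G (x i)) f _
      (fun i => act_one k (f i))).symm
  map_mul' s t := by
    ext1 φ
    apply cochain_ext_act k (s * t)
    intro x f
    rw [cochainAct_act, act_mul]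
    rw [Module.End.mul_apply, cochain_congr (cochainAct k s n (cochainAct k t n φ))
      (x := fun i => s • t • x i) (funext fun i => mul_smul s t (x i))
      (fun i => act k s (act k t (f i))) _ (fun i => act_mul k s t (f i)),
      cochainAct_act, cochainAct_act]

theorem cochainRep_mem_cocycles (s : G) (n : ℕ) (φ : Cochain C k n) (h : φ ∈ cocycles C k n) :
    cochainRep C k G n s φ ∈ cocycles C k n := by
  change d C k n (cochainAct k s n φ) = 0
  rw [← cochainAct_d, (show d C k n φ = 0 from h), map_zero]

theorem cochainRep_mem_coboundaries (s : G) (n : ℕ) (φ : Cochain C k n)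
    (h : φ ∈ coboundaries C k n) : cochainRep C k G n s φ ∈ coboundaries C k n := by
  cases n with
  | zero =>
    obtain rfl : φ = 0 := h
    rw [map_zero]
    exact zero_mem _
  | succ n =>
    obtain ⟨ψ, rfl⟩ := h
    exact ⟨cochainAct k s n ψ, (cochainAct_d k s n ψ).symm⟩

variable (C) in
/-- The action of `G` on cocycles. -/
noncomputable def cocycleAct (s : G) (n : ℕ) : cocycles C k n →ₗ[k] cocycles C k n :=
  (cochainRep C k G n s).restrict (cochainRep_mem_cocycles k s n)

variable (C) in
/-- The representation of `G` on cohomology: `s [φ] = [s φ]`. -/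
noncomputable def HHRep (G : Type t) [Group G] [MulAction G C] [LinearAction k G C] (n : ℕ) :
    Representation k G (HH C k n) where
  toFun s := Submodule.mapQ _ _ (cocycleAct C k s n)
    (fun φ h => cochainRep_mem_coboundaries k s n φ.1 h)
  map_one' := by
    ext φ
    change HH.mk (cocycleAct C k (1 : G) n φ) = HH.mk φ
    congr 1
    apply Subtype.ext
    change cochainRep C k G n 1 φ.1 = φ.1
    rw [map_one, Module.End.one_apply]
  map_mul' s t := by
    ext φ
    change HH.mk (cocycleAct C k (s * t) n φ) =
      HH.mk (cocycleAct C k s n (cocycleAct C k t n φ))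
    congr 1
    apply Subtype.ext
    change cochainRep C k G n (s * t) φ.1 = cochainRep C k G n s (cochainRep C k G n t φ.1)
    rw [map_mul, Module.End.mul_apply]

end Action

section Quotient

/-- The objects of the quotient category `C/G`: the orbits of `G` on the objects of `C`. -/
def OrbitCat (_k : Type w) (G : Type t) (C : Type u) [Group G] [MulAction G C] : Type u :=
  MulAction.orbitRel.Quotient G C

variable {C : Type u} (k : Type w) {G : Type t} [Group G] [MulAction G C]

variable (G) in
/-- The orbit of an object. -/
def orb (x : C) : OrbitCat k G C := Quotient.mk (MulAction.orbitRel G C) x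

theorem orb_smul (s : G) (x : C) : orb k G (s • x) = orb k G x :=
  Quotient.sound ⟨s, rfl⟩

theorem exists_smul_eq_of_orb_eq {x y : C} (h : orb k G x = orb k G y) : ∃ s : G, s • x = y := by
  obtain ⟨s, hs⟩ := Quotient.exact h.symm
  exact ⟨s, hs⟩

theorem exists_orb_eq (α : OrbitCat k G C) : ∃ x : C, orb k G x = α := Quotient.exists_rep α

variable {k}

/-- For objects `y` and `y'` in the same orbit, an element `s` of `G` such that `s y = y'`. It is
unique if the action is free. -/
noncomputable def transporter {y y' : C} (h : orb k G y = orb k G y') : G :=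
  (exists_smul_eq_of_orb_eq k h).choose

theorem transporter_smul {y y' : C} (h : orb k G y = orb k G y') : transporter h • y = y' :=
  (exists_smul_eq_of_orb_eq k h).choose_spec

variable [CommRing k] [Category.{v} C] [Preadditive C] [Linear k C]

/-- The pairs of objects `(x, y)` with `x ∈ α` and `y ∈ β`. -/
abbrev Pair (α β : OrbitCat k G C) : Type u := {p : C × C // orb k G p.1 = α ∧ orb k G p.2 = β}

/-- The direct sum of the spaces of morphisms from objects of `α` to objects of `β`. -/
abbrev HomSum (α β : OrbitCat k G C) : Type max u v :=
  DirectSum (Pair α β) fun p => (p.1.1 ⟶ p.1.2)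

open Classical in
/-- The inclusion of a space of morphisms in the direct sum. -/
noncomputable def HomSum.of {α β : OrbitCat k G C} {x y : C} (hx : orb k G x = α)
    (hy : orb k G y = β) : (x ⟶ y) →ₗ[k] HomSum α β :=
  DirectSum.lof k (Pair α β) (fun p => (p.1.1 ⟶ p.1.2)) ⟨(x, y), hx, hy⟩

variable [LinearAction k G C]

/-- The subspace of the direct sum generated by the differences `s f - f`. -/
noncomputable def coinvRel (α β : OrbitCat k G C) : Submodule k (HomSum α β) :=
  Submodule.span k {m | ∃ (x y : C) (hx : orb k G x = α) (hy : orb k G y = β) (s : G) (f : x ⟶ y),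
    m = HomSum.of ((orb_smul k s x).trans hx) ((orb_smul k s y).trans hy) (act k s f) -
      HomSum.of hx hy f}

/-- The morphisms of `C/G`: the coinvariants of the direct sum. -/
def QuotHom (α β : OrbitCat k G C) : Type max u v := HomSum α β ⧸ coinvRel α β

noncomputable instance (α β : OrbitCat k G C) : AddCommGroup (QuotHom α β) :=
  Submodule.Quotient.addCommGroup (coinvRel α β)

noncomputable instance (α β : OrbitCat k G C) : Module k (QuotHom α β) :=
  Submodule.Quotient.module (coinvRel α β)

/-- The projection of the direct sum onto its coinvariants. -/
noncomputable def QuotHom.mk {α β : OrbitCat k G C} : HomSum α β →ₗ[k] QuotHom α β :=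
  (coinvRel α β).mkQ

/-- The class in `C/G` of a morphism of `C`. -/
noncomputable def cls {α β : OrbitCat k G C} {x y : C} (hx : orb k G x = α) (hy : orb k G y = β) :
    (x ⟶ y) →ₗ[k] QuotHom α β :=
  QuotHom.mk ∘ₗ HomSum.of hx hy

theorem cls_act {α β : OrbitCat k G C} {x y : C} (hx : orb k G x = α) (hy : orb k G y = β) (s : G)
    (f : x ⟶ y) :
    cls ((orb_smul k s x).trans hx) ((orb_smul k s y).trans hy) (act k s f) = cls hx hy f :=
  (Submodule.Quotient.eq _).2 (Submodule.subset_span ⟨x, y, hx, hy, s, f, rfl⟩)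

theorem cls_eqToHom {α β : OrbitCat k G C} {x y x' y' : C} (hx : orb k G x = α) (hy : orb k G y = β)
    (h : x' = x) (h' : y = y') (f : x ⟶ y) :
    cls (h ▸ hx) (h' ▸ hy) (eqToHom h ≫ f ≫ eqToHom h') = cls hx hy f := by
  subst h h'
  simp

theorem QuotHom.induction {α β : OrbitCat k G C} {P : QuotHom α β → Prop} (q : QuotHom α β)
    (h0 : P 0) (hadd : ∀ a b, P a → P b → P (a + b))
    (h : ∀ (x y : C) (hx : orb k G x = α) (hy : orb k G y = β) (f : x ⟶ y), P (cls hx hy f)) :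
    P q := by
  classical
  obtain ⟨m, rfl⟩ := Submodule.mkQ_surjective _ q
  induction m using DirectSum.induction_on with
  | zero => exact (map_zero (QuotHom.mk (α := α) (β := β))).symm ▸ h0
  | of p f => exact h p.1.1 p.1.2 p.2.1 p.2.2 f
  | add a b ha hb => exact (map_add QuotHom.mk a b).symm ▸ hadd _ _ ha hb

theorem QuotHom.induction_source {α β : OrbitCat k G C} {x : C} (hx : orb k G x = α)
    {P : QuotHom α β → Prop} (q : QuotHom α β) (h0 : P 0)
    (hadd : ∀ a b, P a → P b → P (a + b))
    (h : ∀ (y : C) (hy : orb k G y = β) (f : x ⟶ y), P (cls hx hy f)) : P q := by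
  refine QuotHom.induction q h0 hadd fun x' y hx' hy f => ?_
  obtain ⟨s, rfl⟩ := exists_smul_eq_of_orb_eq k (hx'.trans hx.symm)
  rw [← cls_act hx' hy s f]
  exact h _ _ _

open Classical in
/-- The linear map out of the coinvariants defined by an invariant family of linear maps. -/
noncomputable def QuotHom.lift {α β : OrbitCat k G C} {M : Type*} [AddCommGroup M] [Module k M]
    (g : ∀ (x y : C), orb k G x = α → orb k G y = β → ((x ⟶ y) →ₗ[k] M))
    (hg : ∀ (x y : C) (hx : orb k G x = α) (hy : orb k G y = β) (s : G) (f : x ⟶ y),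
      g (s • x) (s • y) ((orb_smul k s x).trans hx) ((orb_smul k s y).trans hy) (act k s f) =
        g x y hx hy f) : QuotHom α β →ₗ[k] M :=
  (coinvRel α β).liftQ
    (DirectSum.toModule k (Pair α β) M fun p => g p.1.1 p.1.2 p.2.1 p.2.2) (by
      refine Submodule.span_le.2 ?_
      rintro _ ⟨x, y, hx, hy, s, f, rfl⟩
      simp only [HomSum.of, SetLike.mem_coe, LinearMap.mem_ker, map_sub,
        DirectSum.toModule_lof]
      exact sub_eq_zero.2 (hg x y hx hy s f))

theorem QuotHom.lift_cls {α β : OrbitCat k G C} {M : Type*} [AddCommGroup M] [Module k M]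
    (g : ∀ (x y : C), orb k G x = α → orb k G y = β → ((x ⟶ y) →ₗ[k] M))
    (hg : ∀ (x y : C) (hx : orb k G x = α) (hy : orb k G y = β) (s : G) (f : x ⟶ y),
      g (s • x) (s • y) ((orb_smul k s x).trans hx) ((orb_smul k s y).trans hy) (act k s f) =
        g x y hx hy f) {x y : C} (hx : orb k G x = α) (hy : orb k G y = β) (f : x ⟶ y) :
    QuotHom.lift g hg (cls hx hy f) = g x y hx hy f := by
  classical
  exact (Submodule.liftQ_apply _ _ _).trans (DirectSum.toModule_lof k (φ := fun p : Pair α β =>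
    g p.1.1 p.1.2 p.2.1 p.2.2) ⟨(x, y), hx, hy⟩ f)

theorem QuotHom.hom_ext {α β : OrbitCat k G C} {M : Type*} [AddCommGroup M] [Module k M]
    {a b : QuotHom α β →ₗ[k] M}
    (h : ∀ (x y : C) (hx : orb k G x = α) (hy : orb k G y = β) (f : x ⟶ y),
      a (cls hx hy f) = b (cls hx hy f)) : a = b := by
  refine LinearMap.ext fun q => ?_
  refine QuotHom.induction (P := fun q => a q = b q) q (by simp) (fun _ _ ha hb => by simp [ha, hb]) h

/-- For `f : x ⟶ y` and `g : y' ⟶ z`, with `y` and `y'` in the same orbit, the class of the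
composite of `s f` and `g`, where `s y = y'`. -/
noncomputable def compAux {α β γ : OrbitCat k G C} {x y : C} (hx : orb k G x = α)
    (hy : orb k G y = β) {y' z : C} (hy' : orb k G y' = β) (hz : orb k G z = γ) :
    (x ⟶ y) →ₗ[k] (y' ⟶ z) →ₗ[k] QuotHom α γ :=
  LinearMap.mk₂ k (fun f g => cls ((orb_smul k _ x).trans hx) hz
      (act k (transporter (hy.trans hy'.symm)) f ≫
        eqToHom (transporter_smul (hy.trans hy'.symm)) ≫ g))
    (fun _ _ _ => by simp) (fun _ _ _ => by simp) (fun _ _ _ => by simp) (fun _ _ _ => by simp)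

/-- The identity of the object `α` of `C/G`: the class of the identity of any object in `α`. -/
noncomputable def QuotHom.id (α : OrbitCat k G C) : QuotHom α α :=
  cls (exists_orb_eq k α).choose_spec (exists_orb_eq k α).choose_spec (𝟙 _)

theorem QuotHom.id_eq {α : OrbitCat k G C} {x : C} (hx : orb k G x = α) :
    QuotHom.id α = cls hx hx (𝟙 x) := by
  have key : ∀ {y : C} (hy : orb k G y = α), cls hy hy (𝟙 y) = cls hx hx (𝟙 x) := by
    intro y hy
    obtain ⟨s, rfl⟩ := exists_smul_eq_of_orb_eq k (hx.trans hy.symm)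
    rw [← cls_act hx hx s, act_id]
  exact key _

variable [IsCancelSMul G C]

theorem compAux_apply {α β γ : OrbitCat k G C} {x y : C} (hx : orb k G x = α)
    (hy : orb k G y = β) {y' z : C} (hy' : orb k G y' = β) (hz : orb k G z = γ) (f : x ⟶ y)
    (g : y' ⟶ z) (s : G) (hs : s • y = y') :
    compAux hx hy hy' hz f g =
      cls ((orb_smul k s x).trans hx) hz (act k s f ≫ eqToHom hs ≫ g) := by
  obtain rfl : s = transporter (hy.trans hy'.symm) :=
    IsCancelSMul.right_cancel _ _ y (hs.trans (transporter_smul _).symm)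
  rfl

theorem compAux_self {α β γ : OrbitCat k G C} {x y z : C} (hx : orb k G x = α)
    (hy : orb k G y = β) (hz : orb k G z = γ) (f : x ⟶ y) (g : y ⟶ z) :
    compAux hx hy hy hz f g = cls hx hz (f ≫ g) := by
  rw [compAux_apply hx hy hy hz f g 1 (one_smul G y), act_one]
  simpa using cls_eqToHom hx hz (one_smul G x) rfl (f ≫ g)

theorem compAux_act_left {α β γ : OrbitCat k G C} {x y : C} (hx : orb k G x = α)
    (hy : orb k G y = β) {y' z : C} (hy' : orb k G y' = β) (hz : orb k G z = γ) (s : G)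
    (f : x ⟶ y) (g : y' ⟶ z) :
    compAux ((orb_smul k s x).trans hx) ((orb_smul k s y).trans hy) hy' hz (act k s f) g =
      compAux hx hy hy' hz f g := by
  obtain ⟨r, rfl⟩ := exists_smul_eq_of_orb_eq k
    (((orb_smul k s y).trans hy).trans hy'.symm)
  rw [compAux_apply _ _ _ hz (act k s f) g r rfl,
    compAux_apply hx hy hy' hz f g (r * s) (mul_smul r s y), act_mul]
  symm
  simpa using cls_eqToHom (((orb_smul k r _).trans (orb_smul k s x)).trans hx) hz
    (mul_smul r s x) rfl (act k r (act k s f) ≫ g)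

theorem compAux_act_right {α β γ : OrbitCat k G C} {x y : C} (hx : orb k G x = α)
    (hy : orb k G y = β) {y' z : C} (hy' : orb k G y' = β) (hz : orb k G z = γ) (s : G)
    (f : x ⟶ y) (g : y' ⟶ z) :
    compAux hx hy ((orb_smul k s y').trans hy') ((orb_smul k s z).trans hz) f (act k s g) =
      compAux hx hy hy' hz f g := by
  obtain ⟨r, rfl⟩ := exists_smul_eq_of_orb_eq k (hy.trans hy'.symm)
  rw [compAux_apply hx hy hy' hz f g r rfl,
    compAux_apply hx hy _ _ f (act k s g) (s * r) (mul_smul s r y), act_mul,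
    ← cls_act ((orb_smul k r x).trans hx) hz s, act_comp, act_comp, act_eqToHom]
  simpa using cls_eqToHom (((orb_smul k s _).trans (orb_smul k r x)).trans hx)
    ((orb_smul k s z).trans hz) (mul_smul s r x) rfl (act k s (act k r f) ≫ act k s g)

/-- The composition of `C/G`. -/
noncomputable def QuotHom.comp (α β γ : OrbitCat k G C) :
    QuotHom α β →ₗ[k] QuotHom β γ →ₗ[k] QuotHom α γ :=
  QuotHom.lift
    (fun x y hx hy => LinearMap.flip (QuotHom.lift
      (fun y' z hy' hz => LinearMap.flip (compAux hx hy hy' hz))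
      (fun y' z hy' hz s g => by
        ext f
        exact compAux_act_right hx hy hy' hz s f g)))
    (fun x y hx hy s f => by
      apply QuotHom.hom_ext
      intro y' z hy' hz g
      simp only [LinearMap.flip_apply, QuotHom.lift_cls]
      exact compAux_act_left hx hy hy' hz s f g)

theorem QuotHom.comp_cls_cls {α β γ : OrbitCat k G C} {x y : C} (hx : orb k G x = α)
    (hy : orb k G y = β) {y' z : C} (hy' : orb k G y' = β) (hz : orb k G z = γ) (f : x ⟶ y)
    (g : y' ⟶ z) :
    QuotHom.comp α β γ (cls hx hy f) (cls hy' hz g) = compAux hx hy hy' hz f g := by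
  simp only [QuotHom.comp, QuotHom.lift_cls, LinearMap.flip_apply]

theorem QuotHom.comp_cls {α β γ : OrbitCat k G C} {x y z : C} (hx : orb k G x = α)
    (hy : orb k G y = β) (hz : orb k G z = γ) (f : x ⟶ y) (g : y ⟶ z) :
    QuotHom.comp α β γ (cls hx hy f) (cls hy hz g) = cls hx hz (f ≫ g) := by
  rw [QuotHom.comp_cls_cls, compAux_self]

noncomputable instance : Category (OrbitCat k G C) where
  Hom α β := QuotHom α β
  id α := QuotHom.id α
  comp {α β γ} f g := QuotHom.comp α β γ f g
  id_comp {α β} q := by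
    obtain ⟨x, hx⟩ := exists_orb_eq k α
    rw [QuotHom.id_eq hx]
    refine QuotHom.induction_source hx (P := fun q => QuotHom.comp α α β (cls hx hx (𝟙 x)) q = q)
      q (map_zero _) (fun a b ha hb => ?_) fun y hy f => ?_
    · rw [map_add, ha, hb]
    · rw [QuotHom.comp_cls, Category.id_comp]
  comp_id {α β} q := by
    obtain ⟨x, hx⟩ := exists_orb_eq k α
    refine QuotHom.induction_source hx (P := fun q => QuotHom.comp α β β q (QuotHom.id β) = q)
      q (LinearMap.map_zero₂ _ _) (fun a b ha hb => ?_) fun y hy f => ?_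
    · rw [map_add, LinearMap.add_apply, ha, hb]
    · rw [QuotHom.id_eq hy, QuotHom.comp_cls, Category.comp_id]
  assoc {α β γ δ} p q r := by
    obtain ⟨x, hx⟩ := exists_orb_eq k α
    refine QuotHom.induction_source hx (P := fun p => QuotHom.comp α γ δ
      (QuotHom.comp α β γ p q) r = QuotHom.comp α β δ p (QuotHom.comp β γ δ q r)) p
      (by simp only [map_zero, LinearMap.zero_apply]) (fun a b ha hb => ?_) fun y hy f => ?_
    · simp only [map_add, LinearMap.add_apply, ha, hb]
    refine QuotHom.induction_source hy (P := fun q => QuotHom.comp α γ δ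
      (QuotHom.comp α β γ (cls hx hy f) q) r =
        QuotHom.comp α β δ (cls hx hy f) (QuotHom.comp β γ δ q r)) q
      (by simp only [map_zero, LinearMap.zero_apply]) (fun a b ha hb => ?_) fun z hz g => ?_
    · simp only [map_add, LinearMap.add_apply, ha, hb]
    refine QuotHom.induction_source hz (P := fun r => QuotHom.comp α γ δ
      (QuotHom.comp α β γ (cls hx hy f) (cls hy hz g)) r =
        QuotHom.comp α β δ (cls hx hy f) (QuotHom.comp β γ δ (cls hy hz g) r)) r
      (by simp only [map_zero]) (fun a b ha hb => ?_) fun w hw h => ?_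
    · simp only [map_add, ha, hb]
    · simp only [QuotHom.comp_cls, Category.assoc]

theorem QuotHom.add_comp {α β γ : OrbitCat k G C} (f f' : QuotHom α β) (g : QuotHom β γ) :
    QuotHom.comp α β γ (f + f') g = QuotHom.comp α β γ f g + QuotHom.comp α β γ f' g := by
  rw [map_add, LinearMap.add_apply]

theorem QuotHom.comp_add {α β γ : OrbitCat k G C} (f : QuotHom α β) (g g' : QuotHom β γ) :
    QuotHom.comp α β γ f (g + g') = QuotHom.comp α β γ f g + QuotHom.comp α β γ f g' := by
  rw [map_add]

theorem QuotHom.smul_comp {α β γ : OrbitCat k G C} (r : k) (f : QuotHom α β) (g : QuotHom β γ) :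
    QuotHom.comp α β γ (r • f) g = r • QuotHom.comp α β γ f g := by
  rw [map_smul, LinearMap.smul_apply]

theorem QuotHom.comp_smul {α β γ : OrbitCat k G C} (f : QuotHom α β) (r : k) (g : QuotHom β γ) :
    QuotHom.comp α β γ f (r • g) = r • QuotHom.comp α β γ f g := by
  rw [map_smul]

noncomputable instance : Preadditive (OrbitCat k G C) where
  homGroup α β := inferInstanceAs (AddCommGroup (QuotHom α β))
  add_comp _ _ _ f f' g := QuotHom.add_comp f f' g
  comp_add _ _ _ f g g' := QuotHom.comp_add f g g'

noncomputable instance : Linear k (OrbitCat k G C) where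
  homModule α β := inferInstanceAs (Module k (QuotHom α β))
  smul_comp _ _ _ r f g := QuotHom.smul_comp r f g
  comp_smul _ _ _ f r g := QuotHom.comp_smul f r g

variable (k G C) in
/-- The Galois covering: the canonical projection functor `C ⥤ C/G`. -/
noncomputable def proj : C ⥤ OrbitCat k G C where
  obj x := orb k G x
  map f := cls rfl rfl f
  map_id _ := (QuotHom.id_eq rfl).symm
  map_comp f g := (QuotHom.comp_cls rfl rfl rfl f g).symm

end Quotient

section Grading

variable {B : Type u} {k : Type w} {G : Type t} [CommRing k] [Group G] [Category.{v} B]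
  [Preadditive B] [Linear k B]

open Classical in
/-- The subspaces `𝒜 s x y` of the spaces of morphisms `x ⟶ y` (the morphisms of degree `s`) form a
`G`-grading of the `k`-category `B`: each space of morphisms is their direct sum, and the composite
of `f` of degree `s` followed by `g` of degree `t` has degree `t * s`. -/
structure IsGrading (𝒜 : G → ∀ x y : B, Submodule k (x ⟶ y)) : Prop where
  isInternal (x y : B) : DirectSum.IsInternal fun s => 𝒜 s x y
  comp_mem {s t : G} {x y z : B} {f : x ⟶ y} {g : y ⟶ z} (hf : f ∈ 𝒜 s x y)
    (hg : g ∈ 𝒜 t y z) : f ≫ g ∈ 𝒜 (t * s) x z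

/-- The product `sₙ ⋯ s₁` of the sequence `(s₁, …, sₙ)`. -/
def degProd {n : ℕ} (s : Fin n → G) : G := (List.ofFn s).reverse.prod

/-- The cochains of class in the conjugacy class `D`: on morphisms `f₁, …, fₙ` which are homogeneous
of degrees `s₁, …, sₙ`, the value is a sum of homogeneous morphisms of degrees `s₀` such that
`sₙ ⋯ s₁ s₀⁻¹` belongs to `D`. -/
def classCochain (𝒜 : G → ∀ x y : B, Submodule k (x ⟶ y)) (D : ConjClasses G) (n : ℕ) :
    Submodule k (Cochain B k n) where
  carrier := {φ | ∀ (x : Fin (n + 1) → B) (s : Fin n → G)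
    (f : ∀ i : Fin n, x i.castSucc ⟶ x i.succ),
    (∀ i, f i ∈ 𝒜 (s i) (x i.castSucc) (x i.succ)) →
      φ x f ∈ ⨆ s₀ : {s₀ : G // ConjClasses.mk (degProd s * s₀⁻¹) = D},
        𝒜 s₀ (x 0) (x (Fin.last n))}
  add_mem' hφ hψ x s f hf := add_mem (hφ x s f hf) (hψ x s f hf)
  zero_mem' _ _ _ _ := zero_mem _
  smul_mem' c _ hφ x s f hf := Submodule.smul_mem _ c (hφ x s f hf)

/-- The cocycles of class in `D`. -/
noncomputable def classCocycles (𝒜 : G → ∀ x y : B, Submodule k (x ⟶ y)) (D : ConjClasses G)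
    (n : ℕ) : Submodule k (Cochain B k n) :=
  cocycles B k n ⊓ classCochain 𝒜 D n

/-- The coboundaries of the cochains of class in `D`. -/
noncomputable def classCoboundaries (𝒜 : G → ∀ x y : B, Submodule k (x ⟶ y))
    (D : ConjClasses G) : ∀ n : ℕ, Submodule k (Cochain B k n)
  | 0 => ⊥
  | n + 1 => (classCochain 𝒜 D n).map (d B k n)

/-- The factor of the cohomology of `B` at the conjugacy class `D`: the cohomology of the complex of
cochains of class in `D`. -/
abbrev HHClass (𝒜 : G → ∀ x y : B, Submodule k (x ⟶ y)) (D : ConjClasses G) (n : ℕ) :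
    Type max u v :=
  classCocycles 𝒜 D n ⧸ (classCoboundaries 𝒜 D n).submoduleOf (classCocycles 𝒜 D n)

theorem classCoboundaries_le (𝒜 : G → ∀ x y : B, Submodule k (x ⟶ y)) (D : ConjClasses G)
    (n : ℕ) : classCoboundaries 𝒜 D n ≤ coboundaries B k n := by
  cases n with
  | zero => exact le_rfl
  | succ n => exact LinearMap.map_le_range

/-- The map from the cohomology of the complex of cochains of class in `D` to the cohomology of `B`
induced by the inclusion. -/
noncomputable def HHClass.toHH (𝒜 : G → ∀ x y : B, Submodule k (x ⟶ y)) (D : ConjClasses G)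
    (n : ℕ) : HHClass 𝒜 D n →ₗ[k] HH B k n :=
  Submodule.mapQ _ _ (Submodule.inclusion inf_le_left) fun _ h => classCoboundaries_le 𝒜 D n h

end Grading

section Galois

variable {C : Type u} {k : Type w} {G : Type t} [CommRing k] [Group G] [Category.{v} C]
  [Preadditive C] [Linear k C] [MulAction G C] [LinearAction k G C] [IsCancelSMul G C]

/-- The morphisms of degree `s` of `C/G`, for a transversal of the action on the objects: if `u α` is
the chosen object of the orbit `α`, they are the classes of the morphisms `s • u α ⟶ u β`. -/
noncomputable def orbitDegree (u : OrbitCat k G C → C) (hu : ∀ α, orb k G (u α) = α) (s : G)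
    (α β : OrbitCat k G C) : Submodule k (α ⟶ β) :=
  LinearMap.range (cls (k := k) (x := s • u α) (y := u β)
    ((orb_smul k s (u α)).trans (hu α)) (hu β) : (s • u α ⟶ u β) →ₗ[k] QuotHom α β)

/-- The cochain `χ` of `C/G` is induced by the cochain `φ` of `C`:
`χ (π fₙ, …, π f₁) = π (φ (fₙ, …, f₁))` for all composable morphisms `f₁, …, fₙ` of `C`, where `π`
is the projection `C ⥤ C/G`. -/
def IsInduced {n : ℕ} (φ : Cochain C k n) (χ : Cochain (OrbitCat k G C) k n) : Prop :=
  ∀ (x : Fin (n + 1) → C) (f : ∀ i : Fin n, x i.castSucc ⟶ x i.succ),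
    χ (fun i => (proj C k G).obj (x i)) (fun i => (proj C k G).map (f i)) =
      (proj C k G).map (φ x f)

end Galois

end HochschildMitchell

open HochschildMitchell

/-! Exactness is used only through averaging: applied to the augmentation `kG → k`, it forces `G` to
be finite with `|G|` invertible in `k`. Averaging then turns every invariant class into the class of
an invariant cocycle.

The geometric input is freeness. Once an object `y` of an orbit is fixed, a morphism of `C/G` into
that orbit is a unique sum of classes of morphisms `x ⟶ y`, so it has a component `coord x y` at
every pair of objects (`sum_cls_coord`). This gives two operations on cochains. Restriction sends
`χ` to the component at `(x₀, xₙ)` of `χ (π fₙ, …, π f₁)`. Components commute with composition by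
classes of morphisms of `C` at either end (`coord_cls_comp`, `coord_comp_cls`), so restriction is a
map of complexes, and its values are invariant. Induction evaluates an invariant `φ` on the
components along all lifts of the objects. A sequence in `C` has `|G|` lifts as a translate of
itself, and each gives the same term, hence the factor `1/|G|` (`isInduced_induceCochain`). A
cochain of `C/G` is determined by its values on images of composable sequences (`cochain_ext_proj`).
Uniqueness therefore shows that induction commutes with the coboundary on invariants and is
compatible with cup products. Restriction after induction is the identity on invariant cochains,
which gives `ι`, its injectivity and the retraction `ρ`.

For a graded category, composing with homogeneous morphisms on both sides conjugates `sₙ ⋯ s₁ s₀⁻¹`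
(`IsGrading.comp_classHom_comp`). The complex thus splits over conjugacy classes, and for finite `G`
the splitting passes to cohomology. For the grading of a transversal, the degrees of the `π fᵢ`
telescope, and the part of the value in the trivial class is its component at `(x₀, xₙ)`. Hence
induction after restriction is the projection to the trivial class
(`induceCochain_restrictCochain`), which identifies both the image of `ι` and `ι ∘ ρ`. -/

/-! ### Exact invariants and the order of the group -/

/-- If the invariants functor of `G` over a field `k` is exact, then `G` is finite and its order is
invertible in `k`. -/
theorem Rep.finite_and_card_ne_zero_of_exactFunctor {k : Type w} [Field k] {G : Type t} [Group G]
    (hexact : exactFunctor (Rep.{max w t} k G) (ModuleCat.{max w t} k)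
      (Rep.invariantsFunctor k G)) :
    Finite G ∧ (Nat.card G : k) ≠ 0 := by
  have hfc : Limits.PreservesFiniteColimits (Rep.invariantsFunctor.{max w t} k G) := hexact.2
  -- The map `f` below is the augmentation `kG → k`, with `k` lifted to the universe of the
  -- representations. It is onto, so exactness lifts `1` to an invariant element `e` of `kG`.
  let A : Rep.{max w t} k G := Rep.trivial k G (ULift.{max w t} k)
  let f := A.leftRegularHom (ULift.up 1)
  have hf : ∀ x, f.hom x = x.coeff.sum fun _ r => (ULift.up r : ULift.{max w t} k) := fun x => by
    change x.coeff.sum (fun g r => r • A.ρ g (ULift.up 1)) = _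
    refine Finsupp.sum_congr fun g _ => ?_
    rw [show A.ρ g (ULift.up 1) = (ULift.up 1 : ULift.{max w t} k) from rfl]
    exact ULift.ext _ _ (mul_one _)
  have hepi : Epi f := (Rep.epi_iff_surjective f).2 fun c =>
    ⟨MonoidAlgebra.single 1 c.down, by
      rw [hf]
      exact Finsupp.sum_single_index rfl⟩
  obtain ⟨⟨e, he⟩, h1⟩ := (ModuleCat.epi_iff_surjective ((Rep.invariantsFunctor k G).map f)).1
    inferInstance ⟨(ULift.up 1 : ULift.{max w t} k), fun g => rfl⟩
  have h1 : f.hom e = (ULift.up 1 : ULift.{max w t} k) := congrArg Subtype.val h1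
  -- Translation by `g⁻¹` moves the coefficient at `g` to the identity, so an invariant element has
  -- constant coefficients. The constant is nonzero since `e` has augmentation `1`. Finite support
  -- then bounds `G`, and the augmentation is `|G|` times the constant.
  have hc : ∀ g, e.coeff g = e.coeff 1 := fun g => by
    have h2 : (Finsupp.mapDomain (g⁻¹ • ·) e.coeff) (g⁻¹ • g) = e.coeff g :=
      Finsupp.mapDomain_apply (MulAction.injective g⁻¹) _ _
    have h3 : Finsupp.mapDomain (g⁻¹ • ·) e.coeff = e.coeff :=
      congrArg MonoidAlgebra.coeff (he g⁻¹)
    rw [h3, smul_eq_mul, inv_mul_cancel] at h2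
    exact h2.symm
  rw [hf] at h1
  have h0 : e.coeff 1 ≠ 0 := fun h0 => by
    have : e.coeff = 0 := Finsupp.ext fun g => (hc g).trans h0
    rw [this, Finsupp.sum_zero_index] at h1
    exact zero_ne_one (congrArg ULift.down h1)
  have hfin : Finite G := Set.finite_univ_iff.1 <| e.coeff.support.finite_toSet.subset
    fun g _ => Finset.mem_coe.2 (Finsupp.mem_support_iff.2 ((hc g).trans_ne h0))
  refine ⟨hfin, fun hG => one_ne_zero (α := k) ?_⟩
  have := Fintype.ofFinite G
  rw [Finsupp.sum_fintype _ _ (fun _ => rfl), Finset.sum_congr rfl fun g _ => by rw [hc g],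
    Finset.sum_const, Finset.card_univ, ← Nat.card_eq_fintype_card] at h1
  refine (congrArg ULift.down h1).symm.trans ?_
  rw [ULift.smul_down, nsmul_eq_mul, hG, zero_mul]

/-! ### Components of the morphisms of the quotient category -/

namespace HochschildMitchell

section Coordinates

variable {C : Type u} {k : Type w} {G : Type t} [Group G] [MulAction G C]
  [CommRing k] [Category.{v} C] [Preadditive C] [Linear k C] [LinearAction k G C]

/-- The map sending `f : x' ⟶ y'` to its translate `x ⟶ y`. -/
noncomputable def translate (s : G) {x y x' y' : C} (hx : s • x' = x) (hy : s • y' = y) :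
    (x' ⟶ y') →ₗ[k] (x ⟶ y) :=
  Linear.leftComp k _ (eqToHom hx.symm) ∘ₗ Linear.rightComp k _ (eqToHom hy) ∘ₗ act k s

theorem translate_apply (s : G) {x y x' y' : C} (hx : s • x' = x) (hy : s • y' = y)
    (f : x' ⟶ y') : translate (k := k) s hx hy f = eqToHom hx.symm ≫ act k s f ≫ eqToHom hy :=
  rfl

theorem translate_self (s : G) {x y : C} (f : x ⟶ y) :
    translate (k := k) s rfl rfl f = act k s f := by
  simp [translate_apply]

theorem translate_translate (s r : G) {x y x' y' x'' y'' : C} (hx : s • x' = x) (hy : s • y' = y)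
    (hx' : r • x'' = x') (hy' : r • y'' = y') (f : x'' ⟶ y'') :
    translate (k := k) s hx hy (translate (k := k) r hx' hy' f) =
      translate (k := k) (s * r) (by rw [mul_smul, hx', hx]) (by rw [mul_smul, hy', hy]) f := by
  subst hx' hy' hx hy
  rw [translate_self, translate_self, translate_apply, act_mul]
  simp

theorem cls_translate {α β : OrbitCat k G C} {x y x' y' : C} (hx : orb k G x = α)
    (hy : orb k G y = β) (hx' : orb k G x' = α) (hy' : orb k G y' = β) (s : G) (h : s • x' = x)
    (h' : s • y' = y) (f : x' ⟶ y') :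
    cls hx hy (translate (k := k) s h h' f) = cls hx' hy' f := by
  subst h h'
  rw [translate_self, ← cls_act hx' hy' s]

theorem QuotHom.induction_target {α β : OrbitCat k G C} {y : C} (hy : orb k G y = β)
    {P : QuotHom α β → Prop} (q : QuotHom α β) (h0 : P 0)
    (hadd : ∀ a b, P a → P b → P (a + b))
    (h : ∀ (x : C) (hx : orb k G x = α) (f : x ⟶ y), P (cls hx hy f)) : P q := by
  refine QuotHom.induction q h0 hadd fun x y' hx hy' f => ?_
  obtain ⟨s, rfl⟩ := exists_smul_eq_of_orb_eq k (hy'.trans hy.symm)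
  rw [← cls_act hx hy' s f]
  exact h _ _ _

variable [IsCancelSMul G C]

theorem smul_right_cancel {s s' : G} {x : C} (h : s • x = s' • x) : s = s' :=
  IsCancelSMul.right_cancel _ _ x h

theorem eq_one_of_smul_eq {s : G} {x : C} (h : s • x = x) : s = 1 :=
  smul_right_cancel (h.trans (one_smul G x).symm)

open Classical in
/-- The translate to `x ⟶ y` of the morphisms `x' ⟶ y'`, if the pair `(x', y')` is a translate of
`(x, y)`, and zero otherwise. -/
noncomputable def coordAux (_k : Type w) (G : Type t) [Group G] [MulAction G C] [CommRing _k]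
    [Linear _k C] [LinearAction _k G C] (x y x' y' : C) :
    (x' ⟶ y') →ₗ[_k] (x ⟶ y) :=
  if h : ∃ s : G, s • x' = x ∧ s • y' = y then
    translate h.choose h.choose_spec.1 h.choose_spec.2 else 0

/-- Freeness makes the translating element unique, so the choice in `coordAux` is harmless. -/
theorem coordAux_eq {x y x' y' : C} (s : G) (hx : s • x' = x) (hy : s • y' = y) :
    coordAux k G x y x' y' = translate s hx hy := by
  have h : ∃ s : G, s • x' = x ∧ s • y' = y := ⟨s, hx, hy⟩
  obtain rfl : s = h.choose := smul_right_cancel (hx.trans h.choose_spec.1.symm)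
  exact dif_pos h

theorem coordAux_eq_zero {x y x' y' : C} (h : ∀ s : G, s • x' = x → s • y' ≠ y) :
    coordAux k G x y x' y' = 0 :=
  dif_neg fun ⟨s, hs, hs'⟩ => h s hs hs'

/-- The component at `x ⟶ y` of a morphism of `C/G`: the class of `f` is sent to the translate
`x ⟶ y` of `f`, if there is one, and to zero otherwise. -/
noncomputable def coord {α β : OrbitCat k G C} (x y : C) :
    QuotHom α β →ₗ[k] (x ⟶ y) :=
  QuotHom.lift (fun x' y' _ _ => coordAux k G x y x' y') (fun x' y' _ _ s f => by
    by_cases h : ∃ r : G, r • s • x' = x ∧ r • s • y' = y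
    · obtain ⟨r, hr, hr'⟩ := h
      rw [coordAux_eq r hr hr', coordAux_eq (r * s) (by rw [mul_smul, hr]) (by rw [mul_smul, hr']),
        ← translate_self, translate_translate]
    · rw [coordAux_eq_zero fun r hr hr' => h ⟨r, hr, hr'⟩, coordAux_eq_zero fun r hr hr' => h
        ⟨r * s⁻¹, by rw [mul_smul, inv_smul_smul, hr], by rw [mul_smul, inv_smul_smul, hr']⟩]
      rfl)

theorem coord_cls {α β : OrbitCat k G C} {x y x' y' : C} (hx' : orb k G x' = α)
    (hy' : orb k G y' = β) (f : x' ⟶ y') (s : G) (hx : s • x' = x) (hy : s • y' = y) :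
    coord x y (cls hx' hy' f) = translate (k := k) s hx hy f := by
  rw [coord, QuotHom.lift_cls, coordAux_eq s hx hy]

theorem coord_cls_self {α β : OrbitCat k G C} {x y : C} (hx : orb k G x = α)
    (hy : orb k G y = β) (f : x ⟶ y) : coord x y (cls hx hy f) = f := by
  rw [coord_cls hx hy f 1 (one_smul G x) (one_smul G y), translate_apply, act_one]
  simp

theorem coord_cls_eq_zero {α β : OrbitCat k G C} {x y x' y' : C} (hx' : orb k G x' = α)
    (hy' : orb k G y' = β) (f : x' ⟶ y') (h : ∀ s : G, s • x' = x → s • y' ≠ y) :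
    coord x y (cls hx' hy' f) = 0 := by
  rw [coord, QuotHom.lift_cls, coordAux_eq_zero h, LinearMap.zero_apply]

/-- The pair of a generator can be moved to `(x', y')` by `r` exactly when it can be moved to `(x,
y)` by `s * r`, so the two components vanish together or differ by `s`. -/
theorem coord_translate {α β : OrbitCat k G C} (q : QuotHom α β) (s : G) {x y x' y' : C}
    (hx : s • x' = x) (hy : s • y' = y) :
    coord x y q = translate (k := k) s hx hy (coord x' y' q) := by
  refine QuotHom.induction (P := fun q => coord x y q = translate (k := k) s hx hy (coord x' y' q))
    q (by simp) (fun a b ha hb => by simp [ha, hb]) fun a b ha hb f => ?_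
  by_cases h : ∃ r : G, r • a = x' ∧ r • b = y'
  · obtain ⟨r, hr, hr'⟩ := h
    rw [coord_cls ha hb f r hr hr', translate_translate, coord_cls]
  · rw [coord_cls_eq_zero ha hb f fun r hr hr' => h ⟨r, hr, hr'⟩, coord_cls_eq_zero ha hb f
      fun r hr hr' => h ⟨s⁻¹ * r, by rw [mul_smul, hr, ← hx, inv_smul_smul],
        by rw [mul_smul, hr', ← hy, inv_smul_smul]⟩, map_zero]

theorem coord_smul {α β : OrbitCat k G C} (q : QuotHom α β) (s : G) (x y : C) :
    coord (s • x) (s • y) q = act k s (coord x y q) := by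
  rw [coord_translate q s rfl rfl, translate_self]

/-- With the target `y` fixed, no freedom remains in a representative: an element fixing `y` is `1`.
The sources `s • x` run once through the orbit, so a generator `s • x ⟶ y` is seen by the summand
`s` alone. -/
theorem sum_cls_coord [Fintype G] {α β : OrbitCat k G C} {x y : C} (hx : orb k G x = α)
    (hy : orb k G y = β) (q : QuotHom α β) :
    ∑ s : G, cls ((orb_smul k s x).trans hx) hy (coord (s • x) y q) = q := by
  refine QuotHom.induction_target hy (P := fun q =>
    ∑ s : G, cls ((orb_smul k s x).trans hx) hy (coord (s • x) y q) = q) q (by simp)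
    (fun a b ha hb => ?_) fun x' hx' f => ?_
  · simp only [map_add, Finset.sum_add_distrib, ha, hb]
  · obtain ⟨s, rfl⟩ := exists_smul_eq_of_orb_eq k (hx.trans hx'.symm)
    rw [Finset.sum_eq_single s, coord_cls_self]
    · intro r _ hr
      rw [coord_cls_eq_zero, map_zero]
      intro a ha ha'
      obtain rfl := eq_one_of_smul_eq ha'
      rw [one_smul] at ha
      exact hr (smul_right_cancel ha).symm
    · simp

/-- Written with target `y`, the morphism `q` composes with `g` without any translation. The result
has target `z`, whose stabiliser is trivial, so only the part of `q` with source `x` reaches the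
component at `(x, z)`. -/
theorem coord_comp_cls {α β γ : OrbitCat k G C} {x y z : C} (hy : orb k G y = β)
    (hz : orb k G z = γ) (q : QuotHom α β) (g : y ⟶ z) :
    coord x z (QuotHom.comp α β γ q (cls hy hz g)) = coord x y q ≫ g := by
  refine QuotHom.induction_target hy (P := fun q =>
    coord x z (QuotHom.comp α β γ q (cls hy hz g)) = coord x y q ≫ g) q (by simp)
    (fun a b ha hb => by simp [ha, hb]) fun x' hx' f => ?_
  rw [QuotHom.comp_cls]
  by_cases h : x' = x
  · subst h
    rw [coord_cls_self, coord_cls_self]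
  · rw [coord_cls_eq_zero hx' hz, coord_cls_eq_zero hx' hy, Limits.zero_comp]
    all_goals
      rintro s hs hs'
      obtain rfl := eq_one_of_smul_eq hs'
      exact h ((one_smul G x').symm.trans hs)

theorem coord_cls_comp {α β γ : OrbitCat k G C} {x y z : C} (hx : orb k G x = α)
    (hy : orb k G y = β) (f : x ⟶ y) (q : QuotHom β γ) :
    coord x z (QuotHom.comp α β γ (cls hx hy f) q) = f ≫ coord y z q := by
  refine QuotHom.induction_source hy (P := fun q =>
    coord x z (QuotHom.comp α β γ (cls hx hy f) q) = f ≫ coord y z q) q (by simp)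
    (fun a b ha hb => by simp [ha, hb]) fun z' hz' g => ?_
  rw [QuotHom.comp_cls]
  by_cases h : z' = z
  · subst h
    rw [coord_cls_self, coord_cls_self]
  · rw [coord_cls_eq_zero hx hz', coord_cls_eq_zero hy hz', Limits.comp_zero]
    all_goals
      rintro s hs hs'
      obtain rfl := eq_one_of_smul_eq hs
      exact h ((one_smul G z').symm.trans hs')

end Coordinates

end HochschildMitchell

/-! ### Graded categories and the splitting of their cohomology by conjugacy classes -/

theorem DirectSum.isInternal_of_projections {k : Type*} [CommRing k] {M : Type*} [AddCommGroup M]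
    [Module k M] {I : Type*} [Fintype I] [DecidableEq I] {A : I → Submodule k M}
    (P : I → M →ₗ[k] M) (hmem : ∀ i m, P i m ∈ A i) (hself : ∀ i, ∀ m ∈ A i, P i m = m)
    (hne : ∀ i j, i ≠ j → ∀ m ∈ A j, P i m = 0) (hsum : ∀ m, ∑ i, P i m = m) :
    DirectSum.IsInternal A := by
  refine ⟨(injective_iff_map_eq_zero _).2 fun m hm => ?_, fun m => ?_⟩
  -- The projection `P i` reads off the `i`-th coordinate of an element of the direct sum, which
  -- gives injectivity.
  · have key : ∀ i, P i ∘ₗ DirectSum.coeLinearMap A =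
        (A i).subtype ∘ₗ DirectSum.component k I (fun i => A i) i := fun i => by
      refine DirectSum.linearMap_ext k fun j => LinearMap.ext fun a => ?_
      simp only [LinearMap.comp_apply, DirectSum.coeLinearMap_lof]
      by_cases h : i = j
      · subst h
        rw [DirectSum.component.lof_self]
        exact hself i _ a.2
      · rw [hne i j h _ a.2, DirectSum.component.of, dif_neg (Ne.symm h), map_zero]
    refine DFinsupp.ext fun i => Subtype.ext ?_
    have := LinearMap.congr_fun (key i) m
    rw [LinearMap.comp_apply, show DirectSum.coeLinearMap A m = 0 from hm, map_zero] at this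
    exact this.symm
  · refine ⟨∑ i, DirectSum.lof k I (fun i => A i) i ⟨P i m, hmem i m⟩, ?_⟩
    change DirectSum.coeLinearMap A _ = m
    simp only [map_sum, DirectSum.coeLinearMap_lof]
    exact hsum m

namespace HochschildMitchell

section Grading

variable {B : Type u} {k : Type w} {G : Type t} [CommRing k] [Group G] [Category.{v} B]
  [Preadditive B] [Linear k B] {𝒜 : G → ∀ x y : B, Submodule k (x ⟶ y)}

open Classical in
/-- The projection of a space of morphisms to its subspace of morphisms of degree `s`. -/
noncomputable def IsGrading.component (h : IsGrading 𝒜) (s : G) (x y : B) :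
    (x ⟶ y) →ₗ[k] (x ⟶ y) :=
  (𝒜 s x y).subtype ∘ₗ DirectSum.component k G (fun s => 𝒜 s x y) s ∘ₗ
    (LinearEquiv.ofBijective (DirectSum.coeLinearMap fun s => 𝒜 s x y)
      (h.isInternal x y)).symm.toLinearMap

theorem IsGrading.component_mem (h : IsGrading 𝒜) (s : G) {x y : B} (f : x ⟶ y) :
    h.component s x y f ∈ 𝒜 s x y :=
  Subtype.property _

open Classical in
theorem IsGrading.symm_of_mem (h : IsGrading 𝒜) {s : G} {x y : B} {f : x ⟶ y}
    (hf : f ∈ 𝒜 s x y) :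
    (LinearEquiv.ofBijective (DirectSum.coeLinearMap fun s => 𝒜 s x y)
      (h.isInternal x y)).symm f = DirectSum.lof k G (fun s => 𝒜 s x y) s ⟨f, hf⟩ :=
  (LinearEquiv.symm_apply_eq _).2 
    (DirectSum.coeLinearMap_lof (fun s => 𝒜 s x y) s ⟨f, hf⟩).symm

theorem IsGrading.component_of_mem (h : IsGrading 𝒜) {s : G} {x y : B} {f : x ⟶ y}
    (hf : f ∈ 𝒜 s x y) : h.component s x y f = f := by
  classical
  simp only [component, LinearMap.comp_apply, LinearEquiv.coe_coe]
  rw [h.symm_of_mem hf, DirectSum.component.lof_self]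
  rfl

theorem IsGrading.component_of_mem_ne (h : IsGrading 𝒜) {s r : G} (hsr : s ≠ r) {x y : B}
    {f : x ⟶ y} (hf : f ∈ 𝒜 r x y) : h.component s x y f = 0 := by
  classical
  simp only [component, LinearMap.comp_apply, LinearEquiv.coe_coe]
  rw [h.symm_of_mem hf, DirectSum.component.of, dif_neg hsr.symm, map_zero]

theorem IsGrading.sum_component [Fintype G] (h : IsGrading 𝒜) {x y : B} (f : x ⟶ y) :
    ∑ s, h.component s x y f = f := by
  classical
  obtain ⟨m, rfl⟩ := (h.isInternal x y).2 f
  induction m using DirectSum.induction_on with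
  | zero => simp
  | of s a =>
    have ha : DirectSum.coeAddMonoidHom (fun s => 𝒜 s x y) (DirectSum.of _ s a) = a :=
      DirectSum.coeAddMonoidHom_of _ _ _
    rw [ha, Finset.sum_eq_single s (fun r _ hr => h.component_of_mem_ne hr a.2) (by simp),
      h.component_of_mem a.2]
  | add a b ha hb => simp only [map_add, Finset.sum_add_distrib, ha, hb]

theorem IsGrading.component_eq [Fintype G] (h : IsGrading 𝒜) {x y : B} {f : x ⟶ y}
    {a : G → (x ⟶ y)} (ha : ∀ s, a s ∈ 𝒜 s x y) (hf : ∑ s, a s = f) (s : G) :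
    h.component s x y f = a s := by
  rw [← hf, map_sum, Finset.sum_eq_single s
    (fun r _ hr => h.component_of_mem_ne hr.symm (ha r)) (by simp), h.component_of_mem (ha s)]

/-- The axioms of a grading do not mention identities. Comparing degrees in `𝟙 ≫ f = f` shows that
the degree `1` part of `𝟙` fixes every homogeneous `f`, in particular all components of `𝟙`, hence
`𝟙` itself. Empty composites in `arrow_mem` rely on this. -/
theorem IsGrading.id_mem [Fintype G] (h : IsGrading 𝒜) (x : B) : 𝟙 x ∈ 𝒜 1 x x := by
  have key : ∀ (s : G) (f : x ⟶ x), f ∈ 𝒜 s x x → h.component 1 x x (𝟙 x) ≫ f = f := by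
    intro s f hf
    -- The shift by `s⁻¹` places the summand of index `r` in degree `s * (s⁻¹ * r) = r`.
    have hsum : ∑ r, h.component (s⁻¹ * r) x x (𝟙 x) ≫ f = f := by
      have h1 : ∑ r, h.component (s⁻¹ * r) x x (𝟙 x) = 𝟙 x :=
        (Fintype.sum_equiv (Equiv.mulLeft s⁻¹) _ (fun r => h.component r x x (𝟙 x))
          (fun _ => rfl)).trans (h.sum_component _)
      rw [← Preadditive.sum_comp, h1, Category.id_comp]
    have := h.component_eq (a := fun r => h.component (s⁻¹ * r) x x (𝟙 x) ≫ f)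
      (fun r => by simpa using h.comp_mem (h.component_mem (s⁻¹ * r) (𝟙 x)) hf) hsum s
    rw [h.component_of_mem hf] at this
    simpa using this.symm
  have h1 : ∀ e : x ⟶ x, (∀ s, e ≫ h.component s x x (𝟙 x) = h.component s x x (𝟙 x)) →
      e = 𝟙 x := fun e he => by
    rw [← Category.comp_id e, ← h.sum_component (𝟙 x), Preadditive.comp_sum,
      Finset.sum_congr rfl fun s _ => he s]
  rw [← h1 _ fun s => key s _ (h.component_mem s (𝟙 x))]
  exact h.component_mem _ _

/-- The sequence `tᵢ` in `G` with `t₀ = 1` and `tᵢ₊₁⁻¹ tᵢ = sᵢ`. -/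
def potential {n : ℕ} (s : Fin n → G) : Fin (n + 1) → G := Fin.partialProd fun i => (s i)⁻¹

theorem potential_succ {n : ℕ} (s : Fin n → G) (i : Fin n) :
    potential s i.succ * s i = potential s i.castSucc := by
  rw [potential, Fin.partialProd_succ, inv_mul_cancel_right]

theorem inv_potential_mul {n : ℕ} (s : Fin n → G) (i : Fin n) :
    (potential s i.succ)⁻¹ * potential s i.castSucc = s i := by
  rw [← potential_succ, inv_mul_cancel_left]

theorem degProd_inv_mul {n : ℕ} (r : Fin (n + 1) → G) :
    degProd (fun i : Fin n => (r i.succ)⁻¹ * r i.castSucc) = (r (Fin.last n))⁻¹ * r 0 := by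
  induction n with
  | zero => simp [degProd]
  | succ n ih =>
    have := ih fun i => r i.castSucc
    rw [degProd] at this ⊢
    rw [List.ofFn_succ', List.concat_eq_append, List.reverse_append, List.prod_append]
    simp only [Fin.succ_castSucc, this, List.reverse_cons, List.reverse_nil, List.nil_append,
      List.prod_cons, List.prod_nil, mul_one, Fin.succ_last, Fin.castSucc_zero]
    group

variable (𝒜) in
/-- The sum of the spaces of morphisms of the degrees `s₀` such that `c s₀⁻¹` belongs to `D`. -/
def classHom (D : ConjClasses G) (c : G) (x y : B) : Submodule k (x ⟶ y) :=
  ⨆ s₀ : {s₀ : G // ConjClasses.mk (c * s₀⁻¹) = D}, 𝒜 s₀ x y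

theorem mem_classHom {D : ConjClasses G} {c s : G} (hs : ConjClasses.mk (c * s⁻¹) = D) {x y : B}
    {f : x ⟶ y} (hf : f ∈ 𝒜 s x y) : f ∈ classHom 𝒜 D c x y :=
  Submodule.mem_iSup_of_mem (p := fun s₀ : {s₀ : G // ConjClasses.mk (c * s₀⁻¹) = D} =>
    𝒜 s₀ x y) ⟨s, hs⟩ hf

/-- Every sequence of degrees has a potential `r`, with which the composite from position `a` to
position `b` has degree `(r b)⁻¹ * r a`. Membership is then easily transported along monotone maps,
without manipulating ordered products. -/
theorem mem_classCochain_iff {D : ConjClasses G} {n : ℕ} {φ : Cochain B k n} :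
    φ ∈ classCochain 𝒜 D n ↔ ∀ (x : Fin (n + 1) → B) (r : Fin (n + 1) → G)
      (f : ∀ i : Fin n, x i.castSucc ⟶ x i.succ),
      (∀ i, f i ∈ 𝒜 ((r i.succ)⁻¹ * r i.castSucc) (x i.castSucc) (x i.succ)) →
        φ x f ∈ classHom 𝒜 D ((r (Fin.last n))⁻¹ * r 0) (x 0) (x (Fin.last n)) := by
  refine ⟨fun h x r f hf => ?_, fun h x s f hf => ?_⟩
  · rw [← degProd_inv_mul]
    exact h x _ f hf
  · have h1 : (fun i => (potential s i.succ)⁻¹ * potential s i.castSucc) = s :=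
      funext (inv_potential_mul s)
    have h2 := h x (potential s) f fun i => by rw [inv_potential_mul]; exact hf i
    rwa [← degProd_inv_mul, h1] at h2

theorem IsGrading.arrow_mem [Fintype G] (h : IsGrading 𝒜) {n : ℕ} (x : Fin (n + 1) → B)
    (r : Fin (n + 1) → G) (f : ∀ i : Fin n, x i.castSucc ⟶ x i.succ)
    (hf : ∀ i, f i ∈ 𝒜 ((r i.succ)⁻¹ * r i.castSucc) (x i.castSucc) (x i.succ))
    {a : Fin (n + 1)} : ∀ {b : Fin (n + 1)} (hab : a ≤ b),
      arrow x f hab ∈ 𝒜 ((r b)⁻¹ * r a) (x a) (x b) := by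
  have h0 : arrow x f (le_refl a) ∈ 𝒜 ((r a)⁻¹ * r a) (x a) (x a) := by
    rw [arrow_self, inv_mul_cancel]
    exact h.id_mem _
  intro b
  induction b using Fin.induction with
  | zero =>
    intro hab
    obtain rfl : a = 0 := Fin.le_zero_iff.1 hab
    exact h0
  | succ j ih =>
    intro hab
    rcases eq_or_lt_of_le hab with rfl | h'
    · exact h0
    · have h1 : a ≤ j.castSucc := Fin.le_castSucc_iff.2 h'
      rw [← arrow_comp x f h1 j.castSucc_lt_succ.le, arrow_succ]
      have := h.comp_mem (ih h1) (hf j)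
      rwa [mul_assoc, mul_inv_cancel_left] at this

/-- If `g` has degree `s`, the composite has degree `b s a`, and `(b c a) (b s a)⁻¹ = b (c s⁻¹)
b⁻¹`. The defect is conjugated, which is why the complex splits over conjugacy classes and not over
elements. -/
theorem IsGrading.comp_classHom_comp (h : IsGrading 𝒜) {D : ConjClasses G} {a b c : G}
    {x y z z' : B} {f : x ⟶ y} {g : y ⟶ z} {g' : z ⟶ z'} (hf : f ∈ 𝒜 a x y)
    (hg : g ∈ classHom 𝒜 D c y z) (hg' : g' ∈ 𝒜 b z z') :
    f ≫ g ≫ g' ∈ classHom 𝒜 D (b * c * a) x z' := by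
  have : classHom 𝒜 D c y z ≤ (classHom 𝒜 D (b * c * a) x z').comap
      (Linear.leftComp k _ f ∘ₗ Linear.rightComp k _ g') := by
    refine iSup_le fun s g hg => mem_classHom (s := b * s.1 * a) ?_
      (h.comp_mem hf (h.comp_mem hg hg'))
    exact (ConjClasses.mk_eq_mk_iff_isConj.2 (isConj_iff.2 ⟨b, by group⟩ :
      IsConj (c * s.1⁻¹) _).symm).trans s.2
  exact this hg

theorem IsGrading.coface_mem_classCochain [Fintype G] (h : IsGrading 𝒜) {D : ConjClasses G}
    {m n : ℕ} (θ : Fin (m + 1) →o Fin (n + 1)) {φ : Cochain B k m}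
    (hφ : φ ∈ classCochain 𝒜 D m) : coface θ φ ∈ classCochain 𝒜 D n := by
  rw [mem_classCochain_iff] at hφ ⊢
  intro x r f hf
  have h1 := hφ (fun i => x (θ i)) (fun i => r (θ i))
    (fun j => arrow x f (θ.monotone j.castSucc_lt_succ.le)) fun i => h.arrow_mem x r f hf _
  have h2 := h.comp_classHom_comp (h.arrow_mem x r f hf (Fin.zero_le (θ 0))) h1
    (h.arrow_mem x r f hf (Fin.le_last (θ (Fin.last m))))
  -- The degrees of the initial, middle and final parts telescope to the degree of the whole
  -- sequence.
  have h3 : (r (Fin.last n))⁻¹ * r (θ (Fin.last m)) * ((r (θ (Fin.last m)))⁻¹ * r (θ 0)) *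
      ((r (θ 0))⁻¹ * r 0) = (r (Fin.last n))⁻¹ * r 0 := by group
  rwa [h3] at h2

theorem IsGrading.d_mem_classCochain [Fintype G] (h : IsGrading 𝒜) {D : ConjClasses G} {n : ℕ}
    {φ : Cochain B k n} (hφ : φ ∈ classCochain 𝒜 D n) : d B k n φ ∈ classCochain 𝒜 D (n + 1) := by
  simp only [d, LinearMap.sum_apply, LinearMap.smul_apply]
  exact sum_mem fun i _ => Submodule.smul_mem _ _ (h.coface_mem_classCochain _ hφ)

/-- A cochain is determined by its values on homogeneous morphisms. -/
theorem IsGrading.cochain_ext [Fintype G] (h : IsGrading 𝒜) {n : ℕ} {φ ψ : Cochain B k n}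
    (H : ∀ (x : Fin (n + 1) → B) (s : Fin n → G) (f : ∀ i : Fin n, x i.castSucc ⟶ x i.succ),
      (∀ i, f i ∈ 𝒜 (s i) (x i.castSucc) (x i.succ)) → φ x f = ψ x f) : φ = ψ := by
  classical
  ext x f
  have hf : f = fun i => ∑ s, h.component s _ _ (f i) := funext fun i => (h.sum_component _).symm
  rw [hf, MultilinearMap.map_sum, MultilinearMap.map_sum]
  exact Finset.sum_congr rfl fun s _ => H x s _ fun i => h.component_mem _ _

open Classical in
/-- The projection to `classHom`. -/
noncomputable def IsGrading.classComponent [Fintype G] (h : IsGrading 𝒜) (D : ConjClasses G)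
    (c : G) (x y : B) : (x ⟶ y) →ₗ[k] (x ⟶ y) :=
  ∑ s₀ with ConjClasses.mk (c * s₀⁻¹) = D, h.component s₀ x y

theorem IsGrading.classComponent_mem [Fintype G] (h : IsGrading 𝒜) (D : ConjClasses G)
    (c : G) {x y : B} (f : x ⟶ y) : h.classComponent D c x y f ∈ classHom 𝒜 D c x y := by
  classical
  rw [classComponent, LinearMap.sum_apply]
  exact sum_mem fun s hs => mem_classHom (Finset.mem_filter.1 hs).2 (h.component_mem s f)

theorem IsGrading.classComponent_of_mem [Fintype G] (h : IsGrading 𝒜) {D : ConjClasses G}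
    {c : G} {x y : B} {f : x ⟶ y} (hf : f ∈ classHom 𝒜 D c x y) :
    h.classComponent D c x y f = f := by
  classical
  have : classHom 𝒜 D c x y ≤ LinearMap.eqLocus (h.classComponent D c x y) LinearMap.id := by
    refine iSup_le fun s f hf => ?_
    rw [LinearMap.mem_eqLocus, classComponent, LinearMap.sum_apply, Finset.sum_eq_single s.1
      (fun r _ hr => h.component_of_mem_ne hr hf) fun hs => (hs (by simp [s.2])).elim,
      h.component_of_mem hf, LinearMap.id_apply]
  exact this hf

theorem IsGrading.classComponent_of_mem_ne [Fintype G] (h : IsGrading 𝒜) {D D' : ConjClasses G}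
    (hD : D ≠ D') {c : G} {x y : B} {f : x ⟶ y} (hf : f ∈ classHom 𝒜 D' c x y) :
    h.classComponent D c x y f = 0 := by
  classical
  have : classHom 𝒜 D' c x y ≤ LinearMap.ker (h.classComponent D c x y) := by
    refine iSup_le fun s f hf => ?_
    rw [LinearMap.mem_ker, classComponent, LinearMap.sum_apply]
    refine Finset.sum_eq_zero fun r hr => h.component_of_mem_ne ?_ hf
    rintro rfl
    exact hD ((Finset.mem_filter.1 hr).2.symm.trans s.2)
  exact this hf

theorem IsGrading.sum_classComponent [Fintype G] [Fintype (ConjClasses G)] (h : IsGrading 𝒜)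
    (c : G) {x y : B} (f : x ⟶ y) : ∑ D, h.classComponent D c x y f = f := by
  classical
  simp only [classComponent, LinearMap.sum_apply]
  rw [Finset.sum_fiberwise, h.sum_component]

/-- The projection to the cochains of class in `D`. -/
noncomputable def IsGrading.classProj [Fintype G] (h : IsGrading 𝒜) (D : ConjClasses G) (n : ℕ) :
    Cochain B k n →ₗ[k] Cochain B k n where
  toFun φ x := ∑ s : Fin n → G, (h.classComponent D (degProd s) _ _).compMultilinearMap
    ((φ x).compLinearMap fun i => h.component (s i) _ _)
  map_add' φ ψ := by
    ext x f
    simp [Finset.sum_add_distrib]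
  map_smul' c φ := by
    ext x f
    simp [Finset.smul_sum]

/-- On homogeneous arguments every multidegree other than `s` has a vanishing argument. Together
with `cochain_ext`, this formula characterises the projection. -/
theorem IsGrading.classProj_apply [Fintype G] (h : IsGrading 𝒜) (D : ConjClasses G) {n : ℕ}
    (φ : Cochain B k n) {x : Fin (n + 1) → B} {s : Fin n → G}
    {f : ∀ i : Fin n, x i.castSucc ⟶ x i.succ}
    (hf : ∀ i, f i ∈ 𝒜 (s i) (x i.castSucc) (x i.succ)) :
    h.classProj D n φ x f = h.classComponent D (degProd s) _ _ (φ x f) := by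
  classical
  have : h.classProj D n φ x f = ∑ s : Fin n → G, h.classComponent D (degProd s) _ _
    (φ x fun i => h.component (s i) _ _ (f i)) := by simp [classProj]
  rw [this, Finset.sum_eq_single s]
  · rw [funext fun i => h.component_of_mem (hf i)]
  · intro r _ hr
    obtain ⟨i, hi⟩ := Function.ne_iff.1 hr
    rw [MultilinearMap.map_coord_zero _ i (h.component_of_mem_ne hi (hf i)), map_zero]
  · simp

theorem IsGrading.classProj_mem [Fintype G] (h : IsGrading 𝒜) (D : ConjClasses G) {n : ℕ}
    (φ : Cochain B k n) : h.classProj D n φ ∈ classCochain 𝒜 D n := fun x s f hf => by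
  rw [h.classProj_apply D φ hf]
  exact h.classComponent_mem _ _ _

theorem IsGrading.classProj_of_mem [Fintype G] (h : IsGrading 𝒜) {D : ConjClasses G} {n : ℕ}
    {φ : Cochain B k n} (hφ : φ ∈ classCochain 𝒜 D n) : h.classProj D n φ = φ :=
  h.cochain_ext fun x s f hf => by
    rw [h.classProj_apply D φ hf, h.classComponent_of_mem (hφ x s f hf)]

theorem IsGrading.classProj_of_mem_ne [Fintype G] (h : IsGrading 𝒜) {D D' : ConjClasses G}
    (hD : D ≠ D') {n : ℕ} {φ : Cochain B k n} (hφ : φ ∈ classCochain 𝒜 D' n) :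
    h.classProj D n φ = 0 :=
  h.cochain_ext fun x s f hf => by
    rw [h.classProj_apply D φ hf, h.classComponent_of_mem_ne hD (hφ x s f hf)]
    rfl

theorem IsGrading.sum_classProj [Fintype G] [Fintype (ConjClasses G)] (h : IsGrading 𝒜) {n : ℕ}
    (φ : Cochain B k n) : ∑ D, h.classProj D n φ = φ :=
  h.cochain_ext fun x s f hf => by
    simp only [Finset.sum_apply, sum_apply, h.classProj_apply _ φ hf,
      h.sum_classComponent]

/-- The coboundary preserves each class, so when `φ` is split into its parts only the part in `D`
survives the projection. -/
theorem IsGrading.classProj_d [Fintype G] (h : IsGrading 𝒜) (D : ConjClasses G) {n : ℕ}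
    (φ : Cochain B k n) :
    h.classProj D (n + 1) (d B k n φ) = d B k n (h.classProj D n φ) := by
  classical
  have := Fintype.ofFinite (ConjClasses G)
  conv_lhs => rw [← h.sum_classProj φ, map_sum, map_sum]
  rw [Finset.sum_eq_single D (fun D' _ hD' => h.classProj_of_mem_ne hD'.symm
    (h.d_mem_classCochain (h.classProj_mem D' φ))) (by simp),
    h.classProj_of_mem (h.d_mem_classCochain (h.classProj_mem D φ))]

theorem IsGrading.classProj_mem_classCocycles [Fintype G] (h : IsGrading 𝒜) (D : ConjClasses G)
    (n : ℕ) (φ : Cochain B k n) (hφ : φ ∈ cocycles B k n) :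
    h.classProj D n φ ∈ classCocycles 𝒜 D n := by
  refine ⟨?_, h.classProj_mem D φ⟩
  change d B k n _ = 0
  rw [← h.classProj_d, show d B k n φ = 0 from hφ, map_zero]

theorem IsGrading.classProj_mem_classCoboundaries [Fintype G] (h : IsGrading 𝒜)
    (D : ConjClasses G) (n : ℕ) (φ : Cochain B k n) (hφ : φ ∈ coboundaries B k n) :
    h.classProj D n φ ∈ classCoboundaries 𝒜 D n := by
  cases n with
  | zero =>
    obtain rfl : φ = 0 := hφ
    rw [map_zero]
    exact zero_mem _
  | succ n =>
    obtain ⟨ψ, rfl⟩ := hφ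
    exact ⟨h.classProj D n ψ, h.classProj_mem D ψ, (h.classProj_d D ψ).symm⟩

/-- The projection of the cohomology to its factor at `D`. -/
noncomputable def IsGrading.toHHClass [Fintype G] (h : IsGrading 𝒜) (D : ConjClasses G) (n : ℕ) :
    HH B k n →ₗ[k] HHClass 𝒜 D n :=
  Submodule.mapQ _ _ ((h.classProj D n).restrict (h.classProj_mem_classCocycles D n))
    fun φ hφ => h.classProj_mem_classCoboundaries D n φ.1 hφ

theorem IsGrading.toHHClass_toHH [Fintype G] (h : IsGrading 𝒜) (D : ConjClasses G) (n : ℕ)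
    (ξ : HHClass 𝒜 D n) : h.toHHClass D n (HHClass.toHH 𝒜 D n ξ) = ξ := by
  obtain ⟨φ, rfl⟩ := Submodule.mkQ_surjective _ ξ
  exact congrArg (Submodule.mkQ _) (Subtype.ext (h.classProj_of_mem φ.2.2))

theorem IsGrading.toHHClass_toHH_of_ne [Fintype G] (h : IsGrading 𝒜) {D D' : ConjClasses G}
    (hD : D' ≠ D) (n : ℕ) (ξ : HHClass 𝒜 D n) :
    h.toHHClass D' n (HHClass.toHH 𝒜 D n ξ) = 0 := by
  obtain ⟨φ, rfl⟩ := Submodule.mkQ_surjective _ ξ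
  exact (congrArg (Submodule.mkQ _) (Subtype.ext (h.classProj_of_mem_ne hD φ.2.2))).trans
    (map_zero _)

theorem IsGrading.sum_toHH_toHHClass [Fintype G] [Fintype (ConjClasses G)] (h : IsGrading 𝒜)
    (n : ℕ) (ξ : HH B k n) : ∑ D, HHClass.toHH 𝒜 D n (h.toHHClass D n ξ) = ξ := by
  obtain ⟨φ, rfl⟩ := Submodule.mkQ_surjective _ ξ
  have : ∀ D, HHClass.toHH 𝒜 D n (h.toHHClass D n (Submodule.mkQ _ φ)) =
      Submodule.mkQ ((coboundaries B k n).submoduleOf (cocycles B k n))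
        ⟨h.classProj D n φ.1, (h.classProj_mem_classCocycles D n φ.1 φ.2).1⟩ := fun D => rfl
  rw [Finset.sum_congr rfl fun D _ => this D, ← map_sum]
  refine congrArg (Submodule.mkQ _) (Subtype.ext ?_)
  rw [AddSubmonoidClass.coe_finsetSum]
  exact h.sum_classProj φ.1

/-- The cohomology of a graded category is the product of its factors at the conjugacy classes. -/
noncomputable def IsGrading.equivHHClass [Fintype G] [Fintype (ConjClasses G)] (h : IsGrading 𝒜)
    (n : ℕ) : HH B k n ≃ₗ[k] (∀ D : ConjClasses G, HHClass 𝒜 D n) :=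
  { LinearMap.pi fun D => h.toHHClass D n with
    invFun ξ := ∑ D, HHClass.toHH 𝒜 D n (ξ D)
    left_inv ξ := h.sum_toHH_toHHClass n ξ
    right_inv ξ := by
      classical
      funext D
      change h.toHHClass D n (∑ D, HHClass.toHH 𝒜 D n (ξ D)) = ξ D
      rw [map_sum, Finset.sum_eq_single D (fun D' _ hD' => h.toHHClass_toHH_of_ne hD'.symm n _)
        (by simp), h.toHHClass_toHH] }

end Grading

end HochschildMitchell

/-! ### Induction and restriction of cochains between `C` and `C/G` -/

namespace HochschildMitchell

section Induced

variable {C : Type u} {k : Type w} {G : Type t} [CommRing k] [Group G] [Category.{v} C]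
  [Preadditive C] [Linear k C] [MulAction G C] [LinearAction k G C] [IsCancelSMul G C]

/-- The map `cls`, with values in the morphisms of the category `C/G`. -/
noncomputable def clsHom {α β : OrbitCat k G C} {x y : C} (hx : orb k G x = α)
    (hy : orb k G y = β) : (x ⟶ y) →ₗ[k] (α ⟶ β) := cls hx hy

/-- The map `coord`, on the morphisms of the category `C/G`. -/
noncomputable def coordHom {α β : OrbitCat k G C} (x y : C) : (α ⟶ β) →ₗ[k] (x ⟶ y) :=
  coord (α := α) (β := β) x y

theorem IsInduced.zero {n : ℕ} :
    IsInduced (0 : Cochain C k n) (0 : Cochain (OrbitCat k G C) k n) := fun x f => by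
  exact (map_zero (clsHom rfl rfl : (x 0 ⟶ x (Fin.last n)) →ₗ[k] (orb k G _ ⟶ orb k G _))).symm

theorem IsInduced.add {n : ℕ} {φ φ' : Cochain C k n} {χ χ' : Cochain (OrbitCat k G C) k n}
    (h : IsInduced φ χ) (h' : IsInduced φ' χ') : IsInduced (φ + φ') (χ + χ') := fun x f => by
  refine (congrArg₂ (· + ·) (h x f) (h' x f)).trans ?_
  exact (map_add (clsHom rfl rfl : (x 0 ⟶ x (Fin.last n)) →ₗ[k] (orb k G _ ⟶ orb k G _))
    _ _).symm

theorem IsInduced.smul {n : ℕ} {φ : Cochain C k n} {χ : Cochain (OrbitCat k G C) k n}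
    (h : IsInduced φ χ) (c : k) : IsInduced (c • φ) (c • χ) := fun x f => by
  refine (congrArg (c • ·) (h x f)).trans ?_
  exact (map_smul (clsHom rfl rfl : (x 0 ⟶ x (Fin.last n)) →ₗ[k] (orb k G _ ⟶ orb k G _))
    _ _).symm

theorem IsInduced.sum {n : ℕ} {I : Type*} (s : Finset I) {φ : I → Cochain C k n}
    {χ : I → Cochain (OrbitCat k G C) k n} (h : ∀ i, IsInduced (φ i) (χ i)) :
    IsInduced (∑ i ∈ s, φ i) (∑ i ∈ s, χ i) := by
  classical
  induction s using Finset.induction_on with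
  | empty => exact IsInduced.zero
  | insert a s ha ih =>
    rw [Finset.sum_insert ha, Finset.sum_insert ha]
    exact (h a).add ih

theorem arrow_proj {n : ℕ} (x : Fin (n + 1) → C) (f : ∀ i : Fin n, x i.castSucc ⟶ x i.succ)
    {a b : Fin (n + 1)} (h : a ≤ b) :
    arrow (fun i => (proj C k G).obj (x i)) (fun i => (proj C k G).map (f i)) h =
      (proj C k G).map (arrow x f h) :=
  (arrow_map (proj C k G) x f h).symm

/-- A coface only composes morphisms along a sequence, and the projection is a functor. -/
theorem IsInduced.coface {m n : ℕ} {φ : Cochain C k m} {χ : Cochain (OrbitCat k G C) k m}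
    (h : IsInduced φ χ) (θ : Fin (m + 1) →o Fin (n + 1)) :
    IsInduced (coface θ φ) (coface θ χ) := fun x f => by
  change cofaceFun θ χ (fun i => (proj C k G).obj (x i)) (fun i => (proj C k G).map (f i)) =
    (proj C k G).map (cofaceFun θ φ x f)
  unfold cofaceFun
  simp only [arrow_proj, Functor.map_comp]
  rw [← h]

theorem IsInduced.d {n : ℕ} {φ : Cochain C k n} {χ : Cochain (OrbitCat k G C) k n}
    (h : IsInduced φ χ) :
    IsInduced (HochschildMitchell.d C k n φ) (HochschildMitchell.d (OrbitCat k G C) k n χ) := by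
  simp only [HochschildMitchell.d, LinearMap.sum_apply, LinearMap.smul_apply]
  exact IsInduced.sum _ fun i => (h.coface _).smul _

theorem IsInduced.cup {m n : ℕ} {ψ : Cochain C k m} {φ : Cochain C k n}
    {ψ' : Cochain (OrbitCat k G C) k m} {φ' : Cochain (OrbitCat k G C) k n}
    (hψ : IsInduced ψ ψ') (hφ : IsInduced φ φ') :
    IsInduced (cup ψ φ) (HochschildMitchell.cup ψ' φ') := fun x f => by
  change cupFun ψ' φ' (fun i => (proj C k G).obj (x i)) (fun i => (proj C k G).map (f i)) =
    (proj C k G).map (cupFun ψ φ x f)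
  refine Eq.trans ?_ ((proj C k G).map_comp (φ (fun i => x (Fin.castLE (by lia) i))
    (fun i => f (Fin.castAdd m i))) (ψ (fun i => x (Fin.natAdd n i))
    (fun i => f (Fin.natAdd n i)))).symm
  exact congrArg₂ (· ≫ ·) (hφ (fun i => x (Fin.castLE (by lia) i))
    (fun i => f (Fin.castAdd m i))) (hψ (fun i => x (Fin.natAdd n i))
    (fun i => f (Fin.natAdd n i)))

theorem isInduced_unitCochain :
    IsInduced (unitCochain C k) (unitCochain (OrbitCat k G C) k) := fun x _ =>
  ((proj C k G).map_id (x 0)).symm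

theorem cls_coord_translate {α β : OrbitCat k G C} {x y x' y' : C} (hx : orb k G x = α)
    (hy : orb k G y = β) (hx' : orb k G x' = α) (hy' : orb k G y' = β) (s : G) (h : s • x' = x)
    (h' : s • y' = y) (q : QuotHom α β) :
    cls hx' hy' (coord x' y' q) = cls hx hy (coord x y q) := by
  rw [coord_translate q s h h', cls_translate hx hy hx' hy']

/-- A cochain of `C/G` is determined by its values on the images of composable morphisms of `C`. -/
theorem cochain_ext_proj [Finite G] {n : ℕ} {χ χ' : Cochain (OrbitCat k G C) k n}
    (h : ∀ (x : Fin (n + 1) → C) (f : ∀ i : Fin n, x i.castSucc ⟶ x i.succ),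
      χ (fun i => (proj C k G).obj (x i)) (fun i => (proj C k G).map (f i)) =
        χ' (fun i => (proj C k G).obj (x i)) (fun i => (proj C k G).map (f i))) : χ = χ' := by
  classical
  have := Fintype.ofFinite G
  funext α
  refine MultilinearMap.ext fun q => ?_
  have hex := fun i => exists_orb_eq k (α i)
  choose x hx using hex
  have hq : q = fun i => ∑ s : G, cls ((orb_smul k s (x i.castSucc)).trans (hx i.castSucc))
      (hx i.succ) (coord (s • x i.castSucc) (x i.succ) (q i)) :=
    funext fun i => (sum_cls_coord (hx i.castSucc) (hx i.succ) (q i)).symm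
  rw [hq]
  refine ((χ α).map_sum _).trans (Eq.trans ?_ ((χ' α).map_sum _).symm)
  refine Finset.sum_congr rfl fun s _ => ?_
  -- The representatives `s i • x i ⟶ x (i + 1)` are not composable. Translating the `i`-th by
  -- `potential s i.succ` gives it the source `potential s i.castSucc • x i`, the target of its
  -- predecessor, and leaves its class unchanged.
  have hx' := fun i => (orb_smul k (potential s i) (x i)).trans (hx i)
  have hs : (fun i => cls ((orb_smul k (s i) (x i.castSucc)).trans (hx i.castSucc))
      (hx i.succ) (coord (s i • x i.castSucc) (x i.succ) (q i))) = fun i =>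
      cls (hx' i.castSucc) (hx' i.succ) (coord _ _ (q i)) := funext fun i =>
    cls_coord_translate _ _ _ _ (potential s i.succ)
      (by rw [← mul_smul, potential_succ]) rfl _
  rw [hs]
  have key : ∀ {β : Fin (n + 1) → OrbitCat k G C} {y : Fin (n + 1) → C}
      (hy : ∀ i, orb k G (y i) = β i) (f : ∀ i : Fin n, y i.castSucc ⟶ y i.succ),
      χ β (fun i => cls (hy _) (hy _) (f i)) = χ' β (fun i => cls (hy _) (hy _) (f i)) := by
    intro β y hy f
    obtain rfl : (fun i => orb k G (y i)) = β := funext hy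
    exact h y f
  exact key hx' _

theorem IsInduced.unique [Finite G] {n : ℕ} {φ : Cochain C k n}
    {χ χ' : Cochain (OrbitCat k G C) k n} (h : IsInduced φ χ) (h' : IsInduced φ χ') : χ = χ' :=
  cochain_ext_proj fun x f => (h x f).trans (h' x f).symm

/-- The cochain of `C` whose value on a composable sequence is the component of the value of the
given cochain of `C/G` on the image of the sequence. -/
noncomputable def restrictCochain (n : ℕ) : Cochain (OrbitCat k G C) k n →ₗ[k] Cochain C k n where
  toFun χ x := (coord (x 0) (x (Fin.last n)) :
      QuotHom (orb k G (x 0)) (orb k G (x (Fin.last n))) →ₗ[k] _).compMultilinearMap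
    ((χ fun i => orb k G (x i)).compLinearMap fun _ => cls rfl rfl)
  map_add' χ χ' := by
    ext x f
    exact map_add (coord (x 0) (x (Fin.last n))) _ _
  map_smul' c χ := by
    ext x f
    exact map_smul (coord (x 0) (x (Fin.last n))) _ _

theorem restrictCochain_apply {n : ℕ} (χ : Cochain (OrbitCat k G C) k n)
    {α : Fin (n + 1) → OrbitCat k G C} {x : Fin (n + 1) → C}
    (hx : ∀ i, orb k G (x i) = α i) (f : ∀ i : Fin n, x i.castSucc ⟶ x i.succ) :
    restrictCochain n χ x f =
      coord (x 0) (x (Fin.last n)) (χ α (fun i => cls (hx _) (hx _) (f i))) := by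
  obtain rfl : (fun i => orb k G (x i)) = α := funext hx
  rfl

theorem restrictCochain_proj {n : ℕ} (χ : Cochain (OrbitCat k G C) k n)
    (x : Fin (n + 1) → C) (f : ∀ i : Fin n, x i.castSucc ⟶ x i.succ) :
    restrictCochain n χ x f = coord (x 0) (x (Fin.last n))
      (χ (fun i => (proj C k G).obj (x i)) (fun i => (proj C k G).map (f i))) := rfl

/-- A morphism of `C` is a component of its own class, so `φ` is recovered from any cochain that it
induces. -/
theorem IsInduced.restrictCochain_eq {n : ℕ} {φ : Cochain C k n}
    {χ : Cochain (OrbitCat k G C) k n} (h : IsInduced φ χ) : restrictCochain n χ = φ := by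
  ext x f
  rw [restrictCochain_proj, h x f]
  exact coord_cls_self rfl rfl _

/-- The outer morphisms of a coface come from `C`, and taking components commutes with composition
by such classes on either side. No condition on `χ` is needed. -/
theorem restrictCochain_coface {m n : ℕ} (θ : Fin (m + 1) →o Fin (n + 1))
    (χ : Cochain (OrbitCat k G C) k m) :
    restrictCochain n (coface θ χ) = coface θ (restrictCochain m χ) := by
  ext x f
  change coord (x 0) (x (Fin.last n)) (cofaceFun θ χ (fun i => (proj C k G).obj (x i))
    (fun i => (proj C k G).map (f i))) = cofaceFun θ (restrictCochain m χ) x f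
  unfold cofaceFun
  simp only [arrow_proj]
  rw [restrictCochain_proj]
  refine (coord_cls_comp rfl rfl _ _).trans (congrArg (_ ≫ ·) ?_)
  exact coord_comp_cls rfl rfl _ _

theorem restrictCochain_d (n : ℕ) (χ : Cochain (OrbitCat k G C) k n) :
    restrictCochain (n + 1) (d (OrbitCat k G C) k n χ) = d C k n (restrictCochain n χ) := by
  simp only [d, LinearMap.sum_apply, LinearMap.smul_apply, map_sum, map_smul,
    restrictCochain_coface]

/-- The morphisms `s fᵢ` and `fᵢ` have the same class, and the component at a translated pair is the
translate of the component. -/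
theorem restrictCochain_mem_invariants (n : ℕ) (χ : Cochain (OrbitCat k G C) k n) :
    restrictCochain n χ ∈ (cochainRep C k G n).invariants := fun s => by
  apply cochain_ext_act k s
  intro x f
  refine (cochainAct_act k s _ x f).trans ?_
  rw [restrictCochain_apply χ (fun i => orb_smul k s (x i)), coord_smul]
  refine congrArg (fun q => act k s (coord (x 0) (x (Fin.last n)) q)) ?_
  exact congrArg (χ fun i => orb k G (x i)) (funext fun i => (cls_act rfl rfl s (f i)).symm)

theorem cochain_act {n : ℕ} {φ : Cochain C k n} (hφ : φ ∈ (cochainRep C k G n).invariants)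
    (s : G) {x y : Fin (n + 1) → C} (h : ∀ i, s • x i = y i)
    (f : ∀ i : Fin n, x i.castSucc ⟶ x i.succ) :
    φ y (fun i => translate (k := k) s (h _) (h _) (f i)) =
      translate (k := k) s (h _) (h _) (φ x f) := by
  obtain rfl : (fun i => s • x i) = y := funext h
  simp only [translate_self]
  rw [← cochainAct_act, show cochainAct k s n φ = φ from hφ s]

/-- The cochain of `C/G` obtained from a cochain of `C` by summing over the lifts of the
objects, divided by the order of the group. -/
noncomputable def induceCochain [Fintype G] [Invertible (Fintype.card G : k)]
    (u : OrbitCat k G C → C) (hu : ∀ α, orb k G (u α) = α) (n : ℕ) :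
    Cochain C k n →ₗ[k] Cochain (OrbitCat k G C) k n where
  toFun φ α := ⅟(Fintype.card G : k) • ∑ g : Fin (n + 1) → G,
    (clsHom ((orb_smul k (g 0) (u (α 0))).trans (hu _))
      ((orb_smul k (g (Fin.last n)) (u (α (Fin.last n)))).trans (hu _))).compMultilinearMap
      ((φ fun i => g i • u (α i)).compLinearMap fun _ => coordHom _ _)
  map_add' φ ψ := by
    ext α q
    simp [Finset.sum_add_distrib]
  map_smul' c φ := by
    ext α q
    simp [← Finset.smul_sum, smul_comm c]

theorem induceCochain_apply [Fintype G] [Invertible (Fintype.card G : k)]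
    (u : OrbitCat k G C → C) (hu : ∀ α, orb k G (u α) = α) {n : ℕ} (φ : Cochain C k n)
    (α : Fin (n + 1) → OrbitCat k G C) (q : ∀ i : Fin n, α i.castSucc ⟶ α i.succ) :
    induceCochain u hu n φ α q = ⅟(Fintype.card G : k) • ∑ g : Fin (n + 1) → G,
      clsHom ((orb_smul k (g 0) (u (α 0))).trans (hu _))
        ((orb_smul k (g (Fin.last n)) (u (α (Fin.last n)))).trans (hu _))
        (φ (fun i => g i • u (α i)) fun i => coordHom _ _ (q i)) := by
  simp [induceCochain]

/-- A family of lifts that is not a translate of the given sequence meets some zero component, so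
its term vanishes. The translates are indexed by `G`. Invariance of `φ` makes each contribute the
class of `φ x f`, and the factor `⅟|G|` removes the multiplicity. -/
theorem isInduced_induceCochain [Fintype G] [Invertible (Fintype.card G : k)]
    (u : OrbitCat k G C → C) (hu : ∀ α, orb k G (u α) = α) {n : ℕ} {φ : Cochain C k n}
    (hφ : φ ∈ (cochainRep C k G n).invariants) : IsInduced φ (induceCochain u hu n φ) := by
  classical
  intro x f
  have hex := fun i => exists_smul_eq_of_orb_eq k (hu (orb k G (x i)))
  choose h hh using hex
  rw [induceCochain_apply]
  -- The element `h i` carries the chosen object of the orbit to `x i`, so the translate `r • x` is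
  -- the family of lifts `r * h i`.
  have hsum := Fintype.sum_of_injective (fun (r : G) i => r * h i)
    (fun r r' hr => mul_right_cancel (congrFun hr 0))
    (fun _ => clsHom (α := orb k G (x 0)) (β := orb k G (x (Fin.last n))) rfl rfl (φ x f))
    (fun g : Fin (n + 1) → G => clsHom ((orb_smul k (g 0) (u (orb k G (x 0)))).trans (hu _))
        ((orb_smul k (g (Fin.last n)) (u (orb k G (x (Fin.last n))))).trans (hu _))
        (φ (fun i => g i • u (orb k G (x i))) fun i => coordHom _ _
          (clsHom rfl rfl (f i) : orb k G (x i.castSucc) ⟶ orb k G (x i.succ)))) ?_ ?_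
  · refine (congrArg (_ • ·) hsum.symm).trans ?_
    rw [Finset.sum_const, Finset.card_univ, ← Nat.cast_smul_eq_nsmul k]
    exact (smul_smul _ _ _).trans ((congrArg (· • _) (invOf_mul_self _)).trans (one_smul _ _))
  · intro g hg
    -- If each consecutive pair of lifts were a translate of the corresponding pair of `x`, freeness
    -- at the shared objects would force a single translating element, namely `g 0 * (h 0)⁻¹`.
    have hex : ∃ i : Fin n, ∀ s : G, s • x i.castSucc = g i.castSucc • u (orb k G (x i.castSucc)) →
        s • x i.succ ≠ g i.succ • u (orb k G (x i.succ)) := by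
      by_contra! H
      refine hg ⟨g 0 * (h 0)⁻¹, funext fun i => ?_⟩
      dsimp only
      induction i using Fin.induction with
      | zero => simp
      | succ i ih =>
        obtain ⟨s, hs, hs'⟩ := H i
        have hs := smul_right_cancel ((mul_smul s _ _).trans ((congrArg (s • ·) (hh _)).trans hs))
        have hs' := smul_right_cancel
          ((mul_smul s _ _).trans ((congrArg (s • ·) (hh _)).trans hs'))
        rw [← hs', ← mul_right_cancel (ih.trans hs.symm)]
    obtain ⟨i, hi⟩ := hex
    rw [MultilinearMap.map_coord_zero _ i (coord_cls_eq_zero rfl rfl (f i) hi), map_zero]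
  · intro r
    have hr : ∀ i, r • x i = (r * h i) • u (orb k G (x i)) := fun i => by rw [mul_smul, hh]
    have hf : (fun i : Fin n => coordHom ((r * h i.castSucc) • u (orb k G (x i.castSucc)))
        ((r * h i.succ) • u (orb k G (x i.succ)))
        (clsHom rfl rfl (f i) : orb k G (x i.castSucc) ⟶ orb k G (x i.succ))) =
        fun i => translate (k := k) r (hr _) (hr _) (f i) :=
      funext fun i => coord_cls rfl rfl (f i) r (hr _) (hr _)
    dsimp only
    rw [hf, cochain_act hφ r hr]
    exact (cls_translate _ _ rfl rfl _ _ _ _).symm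

/-- Both sides are induced by `d φ`, and an induced cochain is unique. -/
theorem induceCochain_d [Fintype G] [Invertible (Fintype.card G : k)]
    (u : OrbitCat k G C → C) (hu : ∀ α, orb k G (u α) = α) {n : ℕ} {φ : Cochain C k n}
    (hφ : φ ∈ (cochainRep C k G n).invariants) :
    induceCochain u hu (n + 1) (d C k n φ) =
      d (OrbitCat k G C) k n (induceCochain u hu n φ) :=
  IsInduced.unique (isInduced_induceCochain u hu fun s =>
    (cochainAct_d k s n φ).trans (congrArg _ (hφ s))) (isInduced_induceCochain u hu hφ).d

end Induced

end HochschildMitchell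

/-! ### The grading of a transversal and its trivial class -/

namespace HochschildMitchell

section OrbitGrading

variable {C : Type u} {k : Type w} {G : Type t} [CommRing k] [Group G] [Category.{v} C]
  [Preadditive C] [Linear k C] [MulAction G C] [LinearAction k G C] [IsCancelSMul G C]

/-- Translation by `b⁻¹` brings the target to the transversal, where the degree is read from the
source. -/
theorem clsHom_mem_orbitDegree (u : OrbitCat k G C → C) (hu : ∀ α, orb k G (u α) = α)
    {α β : OrbitCat k G C} {x y : C} (hx : orb k G x = α) (hy : orb k G y = β) {a b : G}
    (ha : a • u α = x) (hb : b • u β = y) (f : x ⟶ y) :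
    clsHom (k := k) hx hy f ∈ orbitDegree u hu (b⁻¹ * a) α β := by
  have ha' : b⁻¹ • x = (b⁻¹ * a) • u α := by rw [mul_smul, ha]
  have hb' : b⁻¹ • y = u β := by rw [← hb, inv_smul_smul]
  exact ⟨translate b⁻¹ ha' hb' f, cls_translate _ _ hx hy _ _ _ _⟩

theorem isGrading_orbitDegree [Finite G] (u : OrbitCat k G C → C)
    (hu : ∀ α, orb k G (u α) = α) : IsGrading (orbitDegree (k := k) u hu) where
  isInternal α β := by
    classical
    have := Fintype.ofFinite G
    refine DirectSum.isInternal_of_projections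
      (fun s : G => clsHom ((orb_smul k s (u α)).trans (hu α)) (hu β) ∘ₗ
        coordHom (s • u α) (u β))
      (fun s q => ⟨_, rfl⟩) ?_ ?_ fun q => sum_cls_coord (hu α) (hu β) q
    · rintro s _ ⟨f, rfl⟩
      exact congrArg (clsHom _ _) (coord_cls_self ((orb_smul k s (u α)).trans (hu α)) (hu β) f)
    · rintro s r hsr _ ⟨f, rfl⟩
      have h0 : coordHom (k := k) (G := G) (s • u α) (u β)
          (clsHom ((orb_smul k r (u α)).trans (hu α)) (hu β) f) = 0 := by
        refine coord_cls_eq_zero _ _ f fun g hg hg' => ?_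
        obtain rfl := eq_one_of_smul_eq hg'
        rw [one_smul] at hg
        exact hsr (smul_right_cancel hg).symm
      exact (congrArg (clsHom _ _) h0).trans (map_zero _)
  comp_mem {s r α β γ} := by
    rintro _ _ ⟨f, rfl⟩ ⟨g, rfl⟩
    have h := QuotHom.comp_cls_cls ((orb_smul k s (u α)).trans (hu α)) (hu β)
      ((orb_smul k r (u β)).trans (hu β)) (hu γ) f g
    -- The element `r` itself carries the target of `f` to the source of `g`, so the composite
    -- starts at `r • s • u α` and has degree `r * s`.
    rw [compAux_apply _ _ _ _ f g r rfl] at h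
    have h' := clsHom_mem_orbitDegree u hu (((orb_smul k r _).trans (orb_smul k s (u α))).trans
      (hu α)) (hu γ) (mul_smul r s (u α)) (one_smul G (u γ)) (act k r f ≫ eqToHom rfl ≫ g)
    rw [inv_one, one_mul] at h'
    change QuotHom.comp α β γ _ _ ∈ _
    exact h ▸ h'

theorem isGrading_orbitDegree_component [Fintype G] (u : OrbitCat k G C → C)
    (hu : ∀ α, orb k G (u α) = α) {α β : OrbitCat k G C} (q : α ⟶ β) {x y : C}
    (hx : orb k G x = α) (hy : orb k G y = β) {a b : G} (ha : a • u α = x) (hb : b • u β = y) :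
    (isGrading_orbitDegree u hu).component (b⁻¹ * a) α β q = clsHom hx hy (coordHom x y q) := by
  rw [(isGrading_orbitDegree u hu).component_eq (a := fun s =>
    clsHom ((orb_smul k s (u α)).trans (hu α)) (hu β) (coordHom _ _ q)) (fun s => ⟨_, rfl⟩)
    (sum_cls_coord (hu α) (hu β) q)]
  exact cls_coord_translate hx hy _ _ b (by rw [mul_smul, smul_inv_smul, ha]) hb q

/-- The component at the trivial conjugacy class of a cochain of `C/G` is induced by the
restriction of the cochain. -/
theorem isInduced_classProj_one [Fintype G] (u : OrbitCat k G C → C)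
    (hu : ∀ α, orb k G (u α) = α) {n : ℕ} (χ : Cochain (OrbitCat k G C) k n) :
    IsInduced (restrictCochain n χ)
      ((isGrading_orbitDegree u hu).classProj (ConjClasses.mk 1) n χ) := by
  classical
  intro x f
  have hex := fun i => exists_smul_eq_of_orb_eq k (hu (orb k G (x i)))
  choose h hh using hex
  have hf : ∀ i : Fin n, (proj C k G).map (f i) ∈
      orbitDegree u hu ((h i.succ)⁻¹ * h i.castSucc) (orb k G _) (orb k G _) := fun i =>
    clsHom_mem_orbitDegree u hu rfl rfl (hh _) (hh _) (f i)
  -- The degrees of the `π fᵢ` multiply to `(h (Fin.last n))⁻¹ * h 0`. The class of `1` is a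
  -- singleton, so this is the only degree that survives, and its component is the one at `(x 0, x
  -- (Fin.last n))`.
  rw [IsGrading.classProj_apply _ _ _ hf, degProd_inv_mul, IsGrading.classComponent,
    LinearMap.sum_apply, Finset.sum_eq_single ((h (Fin.last n))⁻¹ * h 0)]
  · exact isGrading_orbitDegree_component u hu _ rfl rfl (hh _) (hh _)
  · intro s hs hs'
    have h1 := (Finset.mem_filter.1 hs).2
    rw [ConjClasses.mk_eq_mk_iff_isConj, isConj_one_left, mul_inv_eq_one] at h1
    exact (hs' h1.symm).elim
  · intro hs
    simp at hs

/-- Both cochains are induced by the restriction of `χ`. The transversal `u'` used for induction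
need not be the transversal `u` of the grading. -/
theorem induceCochain_restrictCochain [Fintype G] [Invertible (Fintype.card G : k)]
    (u u' : OrbitCat k G C → C) (hu : ∀ α, orb k G (u α) = α) (hu' : ∀ α, orb k G (u' α) = α)
    {n : ℕ} (χ : Cochain (OrbitCat k G C) k n) :
    induceCochain u' hu' n (restrictCochain n χ) =
      (isGrading_orbitDegree u hu).classProj (ConjClasses.mk 1) n χ :=
  (isInduced_induceCochain u' hu' (restrictCochain_mem_invariants n χ)).unique
    (isInduced_classProj_one u hu χ)

end OrbitGrading

end HochschildMitchell

/-! ### The Leibniz rule and the cup product in cohomology -/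

namespace HochschildMitchell

section CupProduct

variable {B : Type u} [Category.{v} B] {k : Type w} [CommRing k] [Preadditive B] [Linear k B]

theorem arrow_comp_assoc {n : ℕ} (x : Fin (n + 1) → B)
    (f : ∀ i : Fin n, x i.castSucc ⟶ x i.succ) {a b c : Fin (n + 1)} (h : a ≤ b) (h' : b ≤ c)
    {z : B} (g : x c ⟶ z) :
    arrow x f h ≫ arrow x f h' ≫ g = arrow x f (h.trans h') ≫ g := by
  rw [← Category.assoc, arrow_comp]

theorem arrow_reindex {m n : ℕ} (θ : Fin (m + 1) →o Fin (n + 1)) (x : Fin (n + 1) → B)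
    (f : ∀ i : Fin n, x i.castSucc ⟶ x i.succ) {a : Fin (m + 1)} :
    ∀ {b : Fin (m + 1)} (h : a ≤ b),
      arrow (fun i => x (θ i)) (fun j => arrow x f (θ.monotone j.castSucc_lt_succ.le)) h =
        arrow x f (θ.monotone h) := by
  intro b
  induction b using Fin.induction with
  | zero =>
    intro h
    obtain rfl : a = 0 := Fin.le_zero_iff.1 h
    rw [arrow_self, arrow_self]
  | succ j ih =>
    intro h
    rcases eq_or_lt_of_le h with rfl | h'
    · rw [arrow_self, arrow_self]
    · have h1 : a ≤ j.castSucc := Fin.le_castSucc_iff.2 h'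
      rw [← arrow_comp _ _ h1 j.castSucc_lt_succ.le, ih h1, arrow_succ, arrow_comp]

/-- The inclusion of the first `n + 1` elements. -/
def frontHom (n m : ℕ) : Fin (n + 1) →o Fin (n + m + 1) :=
  ⟨fun i => Fin.castLE (by lia) i, fun _ _ h => h⟩

/-- The inclusion of the last `m + 1` elements. -/
def backHom (n m : ℕ) : Fin (m + 1) →o Fin (n + m + 1) :=
  ⟨fun i => Fin.natAdd n i, fun _ _ h => Nat.add_le_add_left h n⟩

/-- The composite of the values of `φ` and `ψ` along two disjoint parts of a composable sequence,
with the remaining morphisms of the sequence. -/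
noncomputable def wideCup {m n N : ℕ} (θ₁ : Fin (n + 1) →o Fin (N + 1))
    (θ₂ : Fin (m + 1) →o Fin (N + 1)) (h : θ₁ (Fin.last n) ≤ θ₂ 0) (ψ : Cochain B k m)
    (φ : Cochain B k n) (x : Fin (N + 1) → B) (f : ∀ i : Fin N, x i.castSucc ⟶ x i.succ) :
    x 0 ⟶ x (Fin.last N) :=
  arrow x f (Fin.zero_le (θ₁ 0)) ≫
    φ (fun i => x (θ₁ i)) (fun j => arrow x f (θ₁.monotone j.castSucc_lt_succ.le)) ≫
      arrow x f h ≫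
        ψ (fun i => x (θ₂ i)) (fun j => arrow x f (θ₂.monotone j.castSucc_lt_succ.le)) ≫
          arrow x f (Fin.le_last (θ₂ (Fin.last m)))

theorem front_le_back {n' m' n m N : ℕ} (κ : Fin (n' + m' + 1) →o Fin (N + 1))
    (θ₁ : Fin (n + 1) →o Fin (n' + 1)) (θ₂ : Fin (m + 1) →o Fin (m' + 1)) :
    (κ.comp ((frontHom n' m').comp θ₁)) (Fin.last n) ≤
      (κ.comp ((backHom n' m').comp θ₂)) 0 := by
  refine κ.monotone (Fin.le_def.2 ?_)
  have := (θ₁ (Fin.last n)).is_le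
  exact this.trans (Nat.le_add_right _ _)

theorem cofaceFun_reindex {m n N : ℕ} (κ : Fin (n + 1) →o Fin (N + 1))
    (θ : Fin (m + 1) →o Fin (n + 1)) (φ : Cochain B k m) (x : Fin (N + 1) → B)
    (f : ∀ i : Fin N, x i.castSucc ⟶ x i.succ) :
    coface θ φ (fun i => x (κ i)) (fun j => arrow x f (κ.monotone j.castSucc_lt_succ.le)) =
      arrow x f (κ.monotone (Fin.zero_le (θ 0))) ≫
        φ (fun i => x (κ (θ i)))
          (fun j => arrow x f (κ.monotone (θ.monotone j.castSucc_lt_succ.le))) ≫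
          arrow x f (κ.monotone (Fin.le_last (θ (Fin.last m)))) := by
  change cofaceFun θ φ _ _ = _
  unfold cofaceFun
  simp only [arrow_reindex]

/-- A normal form: such a cochain depends only on the two composed index maps, which say where `φ`
and `ψ` read the sequence. -/
theorem coface_cup_coface {n' m' n m N : ℕ} (κ : Fin (n' + m' + 1) →o Fin (N + 1))
    (θ₁ : Fin (n + 1) →o Fin (n' + 1)) (θ₂ : Fin (m + 1) →o Fin (m' + 1))
    (ψ : Cochain B k m) (φ : Cochain B k n) (x : Fin (N + 1) → B)
    (f : ∀ i : Fin N, x i.castSucc ⟶ x i.succ) :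
    coface κ (cup (coface θ₂ ψ) (coface θ₁ φ)) x f =
      wideCup (κ.comp ((frontHom n' m').comp θ₁)) (κ.comp ((backHom n' m').comp θ₂))
        (front_le_back κ θ₁ θ₂) ψ φ x f := by
  have h1 := cofaceFun_reindex (κ.comp (frontHom n' m')) θ₁ φ x f
  have h2 := cofaceFun_reindex (κ.comp (backHom n' m')) θ₂ ψ x f
  have hle : κ.comp (frontHom n' m') (Fin.last n') ≤ κ.comp (backHom n' m') 0 :=
    le_of_eq rfl
  -- The front and back parts of a cup product share an object, so the arrow between them is an
  -- identity. It is inserted to match `wideCup`.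
  have h0 : ∀ {z : B} (g : x (κ.comp (backHom n' m') 0) ⟶ z), arrow x f hle ≫ g = g :=
    fun g => (congrArg (· ≫ g) (arrow_self x f _)).trans (Category.id_comp g)
  have h : coface κ (cup (coface θ₂ ψ) (coface θ₁ φ)) x f =
      arrow x f (Fin.zero_le (κ.comp (frontHom n' m') 0)) ≫
        (coface θ₁ φ (fun i => x (κ.comp (frontHom n' m') i))
          (fun j => arrow x f ((κ.comp (frontHom n' m')).monotone j.castSucc_lt_succ.le)) ≫
          arrow x f hle ≫
        coface θ₂ ψ (fun i => x (κ.comp (backHom n' m') i))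
          (fun j => arrow x f ((κ.comp (backHom n' m')).monotone j.castSucc_lt_succ.le))) ≫
        arrow x f (Fin.le_last (κ.comp (backHom n' m') (Fin.last m'))) :=
    congrArg (fun g => arrow x f (Fin.zero_le (κ.comp (frontHom n' m') 0)) ≫
      (coface θ₁ φ (fun i => x (κ.comp (frontHom n' m') i))
        (fun j => arrow x f ((κ.comp (frontHom n' m')).monotone j.castSucc_lt_succ.le)) ≫ g) ≫
      arrow x f (Fin.le_last (κ.comp (backHom n' m') (Fin.last m')))) (h0 _).symm
  rw [h, h1, h2]
  simp only [Category.assoc, arrow_comp_assoc, arrow_comp]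
  rfl

theorem wideCup_congr {m n N : ℕ} {θ₁ θ₁' : Fin (n + 1) →o Fin (N + 1)}
    {θ₂ θ₂' : Fin (m + 1) →o Fin (N + 1)} (h₁ : θ₁ = θ₁') (h₂ : θ₂ = θ₂')
    (h : θ₁ (Fin.last n) ≤ θ₂ 0) (ψ : Cochain B k m) (φ : Cochain B k n) (x : Fin (N + 1) → B)
    (f : ∀ i : Fin N, x i.castSucc ⟶ x i.succ) :
    wideCup θ₁ θ₂ h ψ φ x f = wideCup θ₁' θ₂' (h₁ ▸ h₂ ▸ h) ψ φ x f := by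
  subst h₁ h₂
  rfl

/-- Identities between cofaces of cup products are thereby reduced to arithmetic of indices. -/
theorem coface_cup_coface_congr {n' m' n'' m'' n m N : ℕ}
    (κ : Fin (n' + m' + 1) →o Fin (N + 1)) (θ₁ : Fin (n + 1) →o Fin (n' + 1))
    (θ₂ : Fin (m + 1) →o Fin (m' + 1)) (κ' : Fin (n'' + m'' + 1) →o Fin (N + 1))
    (θ₁' : Fin (n + 1) →o Fin (n'' + 1)) (θ₂' : Fin (m + 1) →o Fin (m'' + 1))
    (h₁ : ∀ i, (κ (frontHom n' m' (θ₁ i)) : ℕ) = κ' (frontHom n'' m'' (θ₁' i)))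
    (h₂ : ∀ i, (κ (backHom n' m' (θ₂ i)) : ℕ) = κ' (backHom n'' m'' (θ₂' i)))
    (ψ : Cochain B k m) (φ : Cochain B k n) :
    coface κ (cup (coface θ₂ ψ) (coface θ₁ φ)) = coface κ' (cup (coface θ₂' ψ) (coface θ₁' φ)) := by
  ext x f
  rw [coface_cup_coface, coface_cup_coface]
  exact wideCup_congr (OrderHom.ext _ _ (funext fun i => Fin.ext (h₁ i)))
    (OrderHom.ext _ _ (funext fun i => Fin.ext (h₂ i))) _ ψ φ x f

variable (B k) in
/-- The cup product as a bilinear map. -/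
noncomputable def cupBilin (m n : ℕ) :
    Cochain B k m →ₗ[k] Cochain B k n →ₗ[k] Cochain B k (n + m) :=
  LinearMap.mk₂ k cup
    (fun _ _ _ => funext fun _ => MultilinearMap.ext fun _ => Preadditive.comp_add _ _ _ _ _ _)
    (fun _ _ _ => funext fun _ => MultilinearMap.ext fun _ => Linear.comp_smul _ _ _ _ _ _)
    (fun _ _ _ => funext fun _ => MultilinearMap.ext fun _ => Preadditive.add_comp _ _ _ _ _ _)
    (fun _ _ _ => funext fun _ => MultilinearMap.ext fun _ => Linear.smul_comp _ _ _ _ _ _)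

theorem cupBilin_apply {m n : ℕ} (ψ : Cochain B k m) (φ : Cochain B k n) :
    cupBilin B k m n ψ φ = cup ψ φ := rfl

/-- The cast along an equality of degrees, as a monotone map. -/
def castHom {M N : ℕ} (h : M = N) : Fin (M + 1) →o Fin (N + 1) :=
  ⟨Fin.cast (congrArg (· + 1) h), fun _ _ h => h⟩

/-- The degrees `n + 1 + m` and `n + m + 1` are only propositionally equal. Expressing the change of
degree as a coface keeps it within the calculus of index maps. -/
theorem coface_castHom_mem_coboundaries {M N : ℕ} (h : M = N) (φ : Cochain B k M) :
    coface (castHom h) φ ∈ coboundaries B k N ↔ φ ∈ coboundaries B k M := by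
  subst h
  rw [show castHom (rfl : M = M) = OrderHom.id from rfl, coface_id]

theorem val_succAbove {n : ℕ} (p : Fin (n + 1)) (i : Fin n) :
    (p.succAbove i : ℕ) = if (i : ℕ) < p then (i : ℕ) else i + 1 := by
  rw [Fin.succAbove]
  split_ifs with h1 h2 h2
  · rfl
  · exact (h2 h1).elim
  · exact (h1 h2).elim
  · rfl

/-- Skipping an object of index at most `n` affects only the part of the sequence read by `φ`. -/
theorem coface_cup_of_le {m n : ℕ} (ψ : Cochain B k m) (φ : Cochain B k n) (i : Fin (n + 1)) :
    coface (Fin.succAboveOrderEmb (⟨i, by lia⟩ : Fin (n + m + 2))).toOrderHom (cup ψ φ) =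
      coface (castHom (Nat.add_right_comm n 1 m))
        (cup ψ (coface (Fin.succAboveOrderEmb i.castSucc).toOrderHom φ)) := by
  have := coface_cup_coface_congr
    (Fin.succAboveOrderEmb (⟨i, by lia⟩ : Fin (n + m + 2))).toOrderHom OrderHom.id OrderHom.id
    (castHom (Nat.add_right_comm n 1 m)) (Fin.succAboveOrderEmb i.castSucc).toOrderHom
    OrderHom.id (fun j => ?_) (fun j => ?_) ψ φ
  · simpa only [coface_id] using this
  · change ((⟨i, _⟩ : Fin (n + m + 2)).succAbove (Fin.castLE (by lia : n + 1 ≤ n + m + 1) j) : ℕ) =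
      (i.castSucc.succAbove j : ℕ)
    rw [val_succAbove, val_succAbove]
    rfl
  · change ((⟨i, _⟩ : Fin (n + m + 2)).succAbove ⟨n + j, _⟩ : ℕ) = n + 1 + j
    rw [val_succAbove, if_neg (by simp; lia)]
    simp only
    lia

theorem coface_cup_of_gt {m n : ℕ} (ψ : Cochain B k m) (φ : Cochain B k n) (j : Fin (m + 1)) :
    coface (Fin.succAboveOrderEmb (⟨n + 1 + j, by lia⟩ : Fin (n + m + 2))).toOrderHom (cup ψ φ) =
      cup (coface (Fin.succAboveOrderEmb j.succ).toOrderHom ψ) φ := by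
  have := coface_cup_coface_congr (n'' := n) (m'' := m + 1) (N := n + m + 1)
    (Fin.succAboveOrderEmb (⟨n + 1 + j, by lia⟩ : Fin (n + m + 2))).toOrderHom OrderHom.id
    OrderHom.id OrderHom.id OrderHom.id (Fin.succAboveOrderEmb j.succ).toOrderHom
    (fun i => ?_) (fun i => ?_) ψ φ
  · simpa only [coface_id] using this
  · change ((⟨n + 1 + j, _⟩ : Fin (n + m + 2)).succAbove ⟨i, _⟩ : ℕ) = i
    rw [val_succAbove, if_pos (by simp only; lia)]
  · change ((⟨n + 1 + j, _⟩ : Fin (n + m + 2)).succAbove ⟨n + i, _⟩ : ℕ) =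
      n + (j.succ.succAbove i : ℕ)
    rw [val_succAbove, val_succAbove]
    simp only [Fin.val_succ]
    split_ifs <;> lia

/-- Both cofaces insert the morphism `x n ⟶ x (n + 1)` between the values of `φ` and `ψ`. This is
the one term not present in the coboundary of the cup product. -/
theorem cup_coface_last {m n : ℕ} (ψ : Cochain B k m) (φ : Cochain B k n) :
    coface (castHom (Nat.add_right_comm n 1 m))
        (cup ψ (coface (Fin.succAboveOrderEmb (Fin.last (n + 1))).toOrderHom φ)) =
      cup (coface (Fin.succAboveOrderEmb 0).toOrderHom ψ) φ := by
  have := coface_cup_coface_congr (n'' := n) (m'' := m + 1) (N := n + m + 1)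
    (castHom (Nat.add_right_comm n 1 m))
    (Fin.succAboveOrderEmb (Fin.last (n + 1))).toOrderHom OrderHom.id
    OrderHom.id OrderHom.id (Fin.succAboveOrderEmb 0).toOrderHom
    (fun i => ?_) (fun i => ?_) ψ φ
  · simpa only [coface_id] using this
  · change ((Fin.last (n + 1)).succAbove i : ℕ) = i
    rw [Fin.succAbove_last]
    rfl
  · change n + 1 + (i : ℕ) = n + ((0 : Fin (m + 2)).succAbove i : ℕ)
    rw [Fin.succAbove_zero, Fin.val_succ]
    lia

/-- The Leibniz rule for the cup product. -/
theorem d_cup {m n : ℕ} (ψ : Cochain B k m) (φ : Cochain B k n) :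
    d B k (n + m) (cup ψ φ) = coface (castHom (Nat.add_right_comm n 1 m)) (cup ψ (d B k n φ)) +
      (-1 : k) ^ n • cup (d B k m ψ) φ := by
  have h1 : d B k (n + m) (cup ψ φ) =
      (∑ i : Fin (n + 1), (-1 : k) ^ (i : ℕ) • coface (castHom (Nat.add_right_comm n 1 m))
        (cup ψ (coface (Fin.succAboveOrderEmb i.castSucc).toOrderHom φ))) +
      ∑ j : Fin (m + 1), (-1 : k) ^ (n + 1 + (j : ℕ)) •
        cup (coface (Fin.succAboveOrderEmb j.succ).toOrderHom ψ) φ := by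
    simp only [d, LinearMap.sum_apply, LinearMap.smul_apply]
    rw [← Fintype.sum_equiv (finCongr (show n + 1 + (m + 1) = n + m + 2 by lia))
      (fun i => (-1 : k) ^ (i : ℕ) • coface (Fin.succAboveOrderEmb
        (⟨i, by lia⟩ : Fin (n + m + 2))).toOrderHom (cup ψ φ)) _ (fun i => rfl), Fin.sum_univ_add]
    congr 1
    · exact Finset.sum_congr rfl fun i _ => congrArg (_ • ·) (coface_cup_of_le ψ φ i)
    · exact Finset.sum_congr rfl fun j _ => congrArg (_ • ·) (coface_cup_of_gt ψ φ j)
  have h2 : coface (castHom (Nat.add_right_comm n 1 m)) (cup ψ (d B k n φ)) =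
      (∑ i : Fin (n + 1), (-1 : k) ^ (i : ℕ) • coface (castHom (Nat.add_right_comm n 1 m))
        (cup ψ (coface (Fin.succAboveOrderEmb i.castSucc).toOrderHom φ))) +
      (-1 : k) ^ (n + 1) • cup (coface (Fin.succAboveOrderEmb 0).toOrderHom ψ) φ := by
    rw [← cup_coface_last]
    simp only [d, LinearMap.sum_apply, LinearMap.smul_apply, ← cupBilin_apply]
    rw [Fin.sum_univ_castSucc]
    simp only [map_sum, map_add, map_smul, Fin.val_castSucc, Fin.val_last]
  have h3 : cup (d B k m ψ) φ = cup (coface (Fin.succAboveOrderEmb 0).toOrderHom ψ) φ +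
      ∑ j : Fin (m + 1), (-1 : k) ^ ((j : ℕ) + 1) •
        cup (coface (Fin.succAboveOrderEmb j.succ).toOrderHom ψ) φ := by
    simp only [d, LinearMap.sum_apply, LinearMap.smul_apply, ← cupBilin_apply]
    rw [Fin.sum_univ_succ]
    simp only [map_sum, map_add, map_smul, LinearMap.add_apply, LinearMap.sum_apply,
      LinearMap.smul_apply, Fin.val_succ, Fin.val_zero, pow_zero, one_smul]
  -- Here `a` is the shared term of `cup_coface_last`: it occurs with sign `(-1) ^ (n + 1)` in `h2`
  -- and `(-1) ^ n` in the multiple of `h3`, and cancels.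
  have key : ∀ (S a : Cochain B k (n + m + 1)) (c : Fin (m + 1) → Cochain B k (n + m + 1)),
      S + ∑ j : Fin (m + 1), (-1 : k) ^ (n + 1 + (j : ℕ)) • c j = S + (-1 : k) ^ (n + 1) • a +
        (-1 : k) ^ n • (a + ∑ j : Fin (m + 1), (-1 : k) ^ ((j : ℕ) + 1) • c j) := fun S a c => by
    rw [smul_add, Finset.smul_sum, pow_succ, mul_neg_one, neg_smul, add_assoc S,
      neg_add_cancel_left]
    congr 1
    refine Finset.sum_congr rfl fun j _ => ?_
    rw [smul_smul, ← pow_add]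
    congr 2
    lia
  rw [h1, h2]
  exact (key _ _ _).trans (congrArg (fun c => _ + (-1 : k) ^ n • c) h3.symm)

theorem cup_mem_cocycles {m n : ℕ} {ψ : Cochain B k m} {φ : Cochain B k n}
    (hψ : ψ ∈ cocycles B k m) (hφ : φ ∈ cocycles B k n) : cup ψ φ ∈ cocycles B k (n + m) := by
  change d B k (n + m) (cup ψ φ) = 0
  rw [d_cup, show d B k m ψ = 0 from hψ, show d B k n φ = 0 from hφ, ← cupBilin_apply,
    ← cupBilin_apply]
  simp

theorem cup_mem_coboundaries_of_right {m n : ℕ} {ψ : Cochain B k m} {φ : Cochain B k n}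
    (hψ : ψ ∈ cocycles B k m) (hφ : φ ∈ coboundaries B k n) :
    cup ψ φ ∈ coboundaries B k (n + m) := by
  cases n with
  | zero =>
    obtain rfl : φ = 0 := hφ
    rw [← cupBilin_apply, map_zero]
    exact zero_mem _
  | succ n =>
    obtain ⟨β, rfl⟩ := hφ
    have h := d_cup ψ β
    rw [show d B k m ψ = 0 from hψ, ← cupBilin_apply 0, map_zero, LinearMap.zero_apply, smul_zero,
      add_zero] at h
    rw [← coface_castHom_mem_coboundaries (Nat.add_right_comm n 1 m), ← h]
    exact ⟨_, rfl⟩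

theorem cup_mem_coboundaries_of_left {m n : ℕ} {ψ : Cochain B k m} {φ : Cochain B k n}
    (hψ : ψ ∈ coboundaries B k m) (hφ : φ ∈ cocycles B k n) :
    cup ψ φ ∈ coboundaries B k (n + m) := by
  cases m with
  | zero =>
    obtain rfl : ψ = 0 := hψ
    rw [← cupBilin_apply, map_zero]
    exact zero_mem _
  | succ m =>
    obtain ⟨α, rfl⟩ := hψ
    have h := d_cup α φ
    have h0 : cup α (0 : Cochain B k (n + 1)) = 0 := map_zero (cupBilin B k m (n + 1) α)
    rw [show d B k n φ = 0 from hφ, h0, map_zero, zero_add] at h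
    -- The factor `(-1) ^ n` undoes the sign in the Leibniz rule.
    refine ⟨(-1 : k) ^ n • cup α φ, (map_smul (d B k (n + m)) _ _).trans ?_⟩
    rw [h, smul_smul, ← mul_pow, neg_one_mul, neg_neg, one_pow, one_smul]

theorem HH.mk_eq_mk {n : ℕ} {φ φ' : cocycles B k n} :
    HH.mk φ = HH.mk φ' ↔ φ.1 - φ'.1 ∈ coboundaries B k n :=
  Submodule.Quotient.eq _

theorem HH.mk_surjective {n : ℕ} (ξ : HH B k n) : ∃ φ : cocycles B k n, HH.mk φ = ξ :=
  Submodule.mkQ_surjective _ ξ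

/-- The class of the cup product depends only on the classes of the factors. -/
theorem HH.mk_cup_congr {m n : ℕ} {ψ ψ' : cocycles B k m} {φ φ' : cocycles B k n}
    (hψ : HH.mk ψ = HH.mk ψ') (hφ : HH.mk φ = HH.mk φ') :
    HH.mk ⟨cup ψ.1 φ.1, cup_mem_cocycles ψ.2 φ.2⟩ =
      HH.mk ⟨cup ψ'.1 φ'.1, cup_mem_cocycles ψ'.2 φ'.2⟩ := by
  rw [HH.mk_eq_mk] at hψ hφ ⊢
  -- The factors are replaced one at a time: `ψ φ - ψ' φ' = (ψ - ψ') φ + ψ' (φ - φ')`.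
  have h := add_mem (cup_mem_coboundaries_of_left hψ φ.2) (cup_mem_coboundaries_of_right ψ'.2 hφ)
  simp only [← cupBilin_apply, map_sub, LinearMap.sub_apply, sub_add_sub_cancel] at h
  exact h

/-- Both cofaces of the unit send `f` to `f`, and they enter the coboundary with opposite signs. -/
theorem unitCochain_mem_cocycles : unitCochain B k ∈ cocycles B k 0 := by
  have h : ∀ (θ : Fin 1 →o Fin 2) (x : Fin 2 → B) (f : ∀ i : Fin 1, x i.castSucc ⟶ x i.succ),
      coface θ (unitCochain B k) x f = arrow x f (Fin.zero_le (Fin.last 1)) := fun θ x f => by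
    change arrow x f (Fin.zero_le (θ 0)) ≫ 𝟙 (x (θ 0)) ≫ arrow x f (Fin.le_last (θ 0)) = _
    rw [Category.id_comp, arrow_comp]
  change d B k 0 (unitCochain B k) = 0
  have h' : ∀ θ θ' : Fin 1 →o Fin 2, coface θ (unitCochain B k) = coface θ' (unitCochain B k) :=
    fun θ θ' => funext fun x => MultilinearMap.ext fun f => (h θ x f).trans (h θ' x f).symm
  rw [d, Fin.sum_univ_two, LinearMap.add_apply, LinearMap.smul_apply, LinearMap.smul_apply,
    h' (Fin.succAboveOrderEmb 1).toOrderHom (Fin.succAboveOrderEmb 0).toOrderHom]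
  simp

end CupProduct

end HochschildMitchell

/-! ### Averaging, and the maps between the cohomologies of `C` and `C/G` -/

theorem Representation.averageMap_apply {k G V : Type*} [CommRing k] [Group G] [AddCommGroup V]
    [Module k V] (ρ : Representation k G V) [Fintype G] [Invertible (Fintype.card G : k)] (v : V) :
    ρ.averageMap v = ⅟(Fintype.card G : k) • ∑ g, ρ g v := by
  simp [GroupAlgebra.average]

namespace HochschildMitchell

section Restriction

variable {C : Type u} {k : Type w} {G : Type t} [CommRing k] [Group G] [Category.{v} C]
  [Preadditive C] [Linear k C] [MulAction G C] [LinearAction k G C] [IsCancelSMul G C]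

theorem HH.mk_mem_invariants {n : ℕ} {φ : cocycles C k n}
    (hφ : φ.1 ∈ (cochainRep C k G n).invariants) : HH.mk φ ∈ (HHRep C k G n).invariants :=
  fun s => congrArg HH.mk (Subtype.ext (hφ s) : cocycleAct C k s n φ = φ)

theorem restrictCochain_mem_cocycles {n : ℕ} {χ : Cochain (OrbitCat k G C) k n}
    (hχ : χ ∈ cocycles (OrbitCat k G C) k n) : restrictCochain n χ ∈ cocycles C k n := by
  change d C k n _ = 0
  rw [← restrictCochain_d, show d (OrbitCat k G C) k n χ = 0 from hχ, map_zero]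

variable (C k G) in
/-- The map in cohomology induced by restricting cochains of `C/G` to `C`. -/
noncomputable def restrictHH (n : ℕ) :
    HH (OrbitCat k G C) k n →ₗ[k] (HHRep C k G n).invariants :=
  LinearMap.codRestrict _ (Submodule.mapQ _ _
    ((restrictCochain n).restrict fun _ hχ => restrictCochain_mem_cocycles hχ) (by
      rintro ⟨χ, hχ⟩ (h : χ ∈ coboundaries _ k n)
      change restrictCochain n χ ∈ coboundaries C k n
      cases n with
      | zero =>
        obtain rfl : χ = 0 := h
        rw [map_zero]
        exact zero_mem _
      | succ n =>
        obtain ⟨ψ, rfl⟩ := h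
        rw [restrictCochain_d]
        exact ⟨_, rfl⟩)) fun ξ => by
    obtain ⟨χ, rfl⟩ := HH.mk_surjective ξ
    exact HH.mk_mem_invariants (φ := ⟨_, restrictCochain_mem_cocycles χ.2⟩)
      (restrictCochain_mem_invariants n χ.1)

theorem restrictHH_mk {n : ℕ} (χ : cocycles (OrbitCat k G C) k n) :
    (restrictHH C k G n (HH.mk χ)).1 =
      HH.mk ⟨restrictCochain n χ.1, restrictCochain_mem_cocycles χ.2⟩ := rfl

end Restriction

section InvariantClasses

variable {C : Type u} {k : Type w} {G : Type t} [CommRing k] [Group G] [Category.{v} C]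
  [Preadditive C] [Linear k C] [MulAction G C] [LinearAction k G C]

theorem unitCochain_mem_invariants : unitCochain C k ∈ (cochainRep C k G 0).invariants :=
    fun s => by
  apply cochain_ext_act k s
  intro x f
  exact (cochainAct_act k s _ x f).trans (act_id k s (x 0))

theorem cup_mem_invariants {m n : ℕ} {ψ : Cochain C k m} {φ : Cochain C k n}
    (hψ : ψ ∈ (cochainRep C k G m).invariants) (hφ : φ ∈ (cochainRep C k G n).invariants) :
    cup ψ φ ∈ (cochainRep C k G (n + m)).invariants := fun s => by
  apply cochain_ext_act k s
  intro x f
  refine (cochainAct_act k s _ x f).trans ?_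
  have h1 := cochainAct_act k s φ (fun i => x (Fin.castLE (by lia) i)) fun i => f (Fin.castAdd m i)
  have h2 := cochainAct_act k s ψ (fun i => x (Fin.natAdd n i)) fun i => f (Fin.natAdd n i)
  rw [show cochainAct k s n φ = φ from hφ s] at h1
  rw [show cochainAct k s m ψ = ψ from hψ s] at h2
  exact (act_comp k s _ _).trans (congrArg₂ (· ≫ ·) h1.symm h2.symm)

variable [Fintype G] [Invertible (Fintype.card G : k)]

theorem averageMap_d {n : ℕ} (φ : Cochain C k n) :
    (cochainRep C k G (n + 1)).averageMap (d C k n φ) =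
      d C k n ((cochainRep C k G n).averageMap φ) := by
  rw [Representation.averageMap_apply, Representation.averageMap_apply, map_smul, map_sum]
  exact congrArg _ (Finset.sum_congr rfl fun s _ => cochainAct_d k s n φ)

theorem averageMap_mem_cocycles {n : ℕ} {φ : Cochain C k n} (hφ : φ ∈ cocycles C k n) :
    (cochainRep C k G n).averageMap φ ∈ cocycles C k n := by
  change d C k n _ = 0
  rw [← averageMap_d, show d C k n φ = 0 from hφ, map_zero]

/-- Averaging commutes with passing to classes, so averaging a representative of an invariant class
does not change the class. -/
theorem HH.mk_averageMap {n : ℕ} (φ : cocycles C k n) :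
    HH.mk ⟨(cochainRep C k G n).averageMap φ.1, averageMap_mem_cocycles φ.2⟩ =
      (HHRep C k G n).averageMap (HH.mk φ) := by
  have h : (⟨(cochainRep C k G n).averageMap φ.1, averageMap_mem_cocycles φ.2⟩ : cocycles C k n) =
      ⅟(Fintype.card G : k) • ∑ g : G, cocycleAct C k g n φ := by
    refine Subtype.ext ?_
    rw [Submodule.coe_smul, AddSubmonoidClass.coe_finsetSum]
    exact Representation.averageMap_apply _ _
  rw [h, map_smul, map_sum, Representation.averageMap_apply]
  rfl

/-- Every invariant class is the class of an invariant cocycle. -/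
theorem HH.exists_invariant_cocycle {n : ℕ} {ξ : HH C k n}
    (hξ : ξ ∈ (HHRep C k G n).invariants) :
    ∃ φ : cocycles C k n, φ.1 ∈ (cochainRep C k G n).invariants ∧ HH.mk φ = ξ := by
  obtain ⟨φ, rfl⟩ := HH.mk_surjective ξ
  exact ⟨⟨(cochainRep C k G n).averageMap φ.1, averageMap_mem_cocycles φ.2⟩,
    Representation.averageMap_invariant _ _,
    (HH.mk_averageMap φ).trans (Representation.averageMap_id _ _ hξ)⟩

variable [IsCancelSMul G C]

theorem induceCochain_mem_cocycles (u : OrbitCat k G C → C) (hu : ∀ α, orb k G (u α) = α) {n : ℕ}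
    {φ : Cochain C k n} (hφ : φ ∈ (cochainRep C k G n).invariants) (h : φ ∈ cocycles C k n) :
    induceCochain u hu n φ ∈ cocycles (OrbitCat k G C) k n := by
  change d (OrbitCat k G C) k n _ = 0
  rw [← induceCochain_d u hu hφ, show d C k n φ = 0 from h, map_zero]

/-- The map in cohomology induced by averaging cochains of `C` and inducing them to `C/G`. -/
noncomputable def induceHH (u : OrbitCat k G C → C) (hu : ∀ α, orb k G (u α) = α) (n : ℕ) :
    HH C k n →ₗ[k] HH (OrbitCat k G C) k n :=
  -- Induction is known to commute with the coboundary only on invariant cochains. Averaging first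
  -- gives a linear map on all cocycles, with no choice of invariant representatives, and
  -- coboundaries remain coboundaries of invariant cochains.
  Submodule.mapQ _ _ ((induceCochain u hu n ∘ₗ (cochainRep C k G n).averageMap).restrict
    fun _ hφ => induceCochain_mem_cocycles u hu (Representation.averageMap_invariant _ _)
      (averageMap_mem_cocycles hφ)) (by
    rintro ⟨φ, hφ⟩ (h : φ ∈ coboundaries C k n)
    change induceCochain u hu n ((cochainRep C k G n).averageMap φ) ∈ coboundaries _ k n
    cases n with
    | zero =>
      obtain rfl : φ = 0 := h
      rw [map_zero, map_zero]
      exact zero_mem _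
    | succ n =>
      obtain ⟨ψ, rfl⟩ := h
      rw [averageMap_d, induceCochain_d u hu (Representation.averageMap_invariant _ _)]
      exact ⟨_, rfl⟩)

theorem induceHH_mk (u : OrbitCat k G C → C) (hu : ∀ α, orb k G (u α) = α) {n : ℕ}
    (φ : cocycles C k n) (hφ : φ.1 ∈ (cochainRep C k G n).invariants) :
    induceHH u hu n (HH.mk φ) =
      HH.mk ⟨induceCochain u hu n φ.1, induceCochain_mem_cocycles u hu hφ φ.2⟩ :=
  congrArg HH.mk (Subtype.ext (congrArg (induceCochain u hu n)
    (Representation.averageMap_id _ _ hφ)))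

theorem induceHH_mk_of_isInduced (u : OrbitCat k G C → C) (hu : ∀ α, orb k G (u α) = α) {n : ℕ}
    {φ : cocycles C k n} (hφ : φ.1 ∈ (cochainRep C k G n).invariants)
    {χ : cocycles (OrbitCat k G C) k n} (h : IsInduced φ.1 χ.1) :
    induceHH u hu n (HH.mk φ) = HH.mk χ :=
  (induceHH_mk u hu φ hφ).trans
    (congrArg HH.mk (Subtype.ext ((isInduced_induceCochain u hu hφ).unique h)))

theorem restrictHH_induceHH (u : OrbitCat k G C → C) (hu : ∀ α, orb k G (u α) = α) {n : ℕ}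
    (ξ : (HHRep C k G n).invariants) : restrictHH C k G n (induceHH u hu n ξ.1) = ξ := by
  obtain ⟨ξ, hξ⟩ := ξ
  obtain ⟨φ, hφ, rfl⟩ := HH.exists_invariant_cocycle hξ
  refine Subtype.ext ?_
  rw [induceHH_mk u hu φ hφ, restrictHH_mk]
  exact congrArg HH.mk (Subtype.ext (isInduced_induceCochain u hu hφ).restrictCochain_eq)

/-- A restricted cochain is already invariant, so averaging does nothing and the identity of
cochains descends. -/
theorem induceHH_restrictHH (u u' : OrbitCat k G C → C) (hu : ∀ α, orb k G (u α) = α)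
    (hu' : ∀ α, orb k G (u' α) = α) {n : ℕ} (ξ : HH (OrbitCat k G C) k n) :
    induceHH u' hu' n (restrictHH C k G n ξ).1 =
      HHClass.toHH (orbitDegree u hu) (ConjClasses.mk (1 : G)) n
        ((isGrading_orbitDegree u hu).toHHClass (ConjClasses.mk 1) n ξ) := by
  obtain ⟨χ, rfl⟩ := HH.mk_surjective ξ
  rw [restrictHH_mk, induceHH_mk u' hu' _ (restrictCochain_mem_invariants n χ.1)]
  exact congrArg HH.mk (Subtype.ext (induceCochain_restrictCochain u u' hu hu' χ.1))

theorem IsGrading.equivHHClass_toHH {B : Type u} [Category.{v} B] [Preadditive B] [Linear k B]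
    {𝒜 : G → ∀ x y : B, Submodule k (x ⟶ y)} [Fintype (ConjClasses G)] (h : IsGrading 𝒜)
    {n : ℕ} (D : ConjClasses G) (ξ : HHClass 𝒜 D n) :
    h.equivHHClass n (HHClass.toHH 𝒜 D n ξ) D = ξ ∧ ∀ D' : ConjClasses G, D' ≠ D →
      h.equivHHClass n (HHClass.toHH 𝒜 D n ξ) D' = 0 :=
  ⟨h.toHHClass_toHH D n ξ, fun _ hD' => h.toHHClass_toHH_of_ne hD' n ξ⟩

/-- The image of the invariant classes is the factor at the trivial conjugacy class. -/
theorem range_induceHH (u u' : OrbitCat k G C → C) (hu : ∀ α, orb k G (u α) = α)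
    (hu' : ∀ α, orb k G (u' α) = α) (n : ℕ) :
    LinearMap.range (induceHH u' hu' n ∘ₗ (HHRep C k G n).invariants.subtype) =
      LinearMap.range (HHClass.toHH (orbitDegree u hu) (ConjClasses.mk (1 : G)) n) := by
  apply le_antisymm
  · rintro _ ⟨ξ, rfl⟩
    -- A class in the image is fixed by induction after restriction, which lands in the trivial
    -- factor.
    refine ⟨_, (induceHH_restrictHH u u' hu hu' (induceHH u' hu' n ξ.1)).symm.trans ?_⟩
    rw [restrictHH_induceHH]
    rfl
  · rintro _ ⟨ξ, rfl⟩
    have h := induceHH_restrictHH u u' hu hu'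
      (HHClass.toHH (orbitDegree u hu) (ConjClasses.mk (1 : G)) n ξ)
    rw [IsGrading.toHHClass_toHH] at h
    exact ⟨restrictHH C k G n (HHClass.toHH _ _ n ξ), h⟩

/-- Induction in cohomology is compatible with cup products of invariant classes. -/
theorem induceHH_cup (u : OrbitCat k G C → C) (hu : ∀ α, orb k G (u α) = α) {m n : ℕ}
    {ψ : cocycles C k m} {φ : cocycles C k n} (hψ : HH.mk ψ ∈ (HHRep C k G m).invariants)
    (hφ : HH.mk φ ∈ (HHRep C k G n).invariants) {ψ' : cocycles (OrbitCat k G C) k m}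
    {φ' : cocycles (OrbitCat k G C) k n} (hψ' : induceHH u hu m (HH.mk ψ) = HH.mk ψ')
    (hφ' : induceHH u hu n (HH.mk φ) = HH.mk φ') :
    HH.mk ⟨cup ψ.1 φ.1, cup_mem_cocycles ψ.2 φ.2⟩ ∈ (HHRep C k G (n + m)).invariants ∧
      induceHH u hu (n + m) (HH.mk ⟨cup ψ.1 φ.1, cup_mem_cocycles ψ.2 φ.2⟩) =
        HH.mk ⟨cup ψ'.1 φ'.1, cup_mem_cocycles ψ'.2 φ'.2⟩ := by
  -- The given representatives need not be invariant. Invariant ones are substituted, which changes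
  -- neither the classes nor the class of the cup product.
  obtain ⟨ψ₁, hψ₁, hψ₂⟩ := HH.exists_invariant_cocycle hψ
  obtain ⟨φ₁, hφ₁, hφ₂⟩ := HH.exists_invariant_cocycle hφ
  rw [← hψ₂, induceHH_mk u hu ψ₁ hψ₁] at hψ'
  rw [← hφ₂, induceHH_mk u hu φ₁ hφ₁] at hφ'
  have hinv := cup_mem_invariants hψ₁ hφ₁
  rw [← HH.mk_cup_congr hψ₂ hφ₂, ← HH.mk_cup_congr hψ' hφ']
  exact ⟨HH.mk_mem_invariants hinv, induceHH_mk_of_isInduced u hu hinv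
    ((isInduced_induceCochain u hu hψ₁).cup (isInduced_induceCochain u hu hφ₁))⟩

end InvariantClasses

end HochschildMitchell

/-! ### The main theorem -/

set_option maxHeartbeats 400000 in
theorem mainTheorem9 {k : Type w} [Field k] {G : Type t} [Group G]
    {C : Type u} [Category.{v} C] [Preadditive C] [Linear k C]
    [MulAction G C] [LinearAction k G C] [IsCancelSMul G C]
    (hexact : exactFunctor (Rep.{max w t} k G) (ModuleCat.{max w t} k)
      (Rep.invariantsFunctor k G)) :
    ∃ (ι : ∀ n : ℕ, (HHRep C k G n).invariants →ₗ[k]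
        HH (OrbitCat k G C) k n)
      (ρ : ∀ n : ℕ, HH (OrbitCat k G C) k n →ₗ[k]
        (HHRep C k G n).invariants),
      -- every invariant class is the class of an invariant cocycle
      (∀ (n : ℕ) (ξ : (HHRep C k G n).invariants),
        ∃ φ : cocycles C k n,
          φ.1 ∈ (cochainRep C k G n).invariants ∧
            HH.mk φ = ξ.1) ∧
      -- `ι` sends the class of an invariant cocycle to the class of the induced cocycle of `C/G`
      (∀ (n : ℕ) (φ : cocycles C k n),
        φ.1 ∈ (cochainRep C k G n).invariants →
          ∃ χ : cocycles (OrbitCat k G C) k n,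
            IsInduced φ.1 χ.1 ∧
            (∀ χ' : Cochain (OrbitCat k G C) k n,
              IsInduced φ.1 χ' → χ' = χ.1) ∧
            ∃ h : HH.mk φ ∈ (HHRep C k G n).invariants,
              ι n ⟨HH.mk φ, h⟩ = HH.mk χ) ∧
      -- `ι` is injective, with retraction `ρ`
      (∀ n : ℕ, Function.Injective (ι n)) ∧
      (∀ n : ℕ, ρ n ∘ₗ ι n = LinearMap.id) ∧
      -- `ι` is compatible with the unit and with cup products
      (∃ (e : cocycles C k 0)
          (he : HH.mk e ∈ (HHRep C k G 0).invariants)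
          (e' : cocycles (OrbitCat k G C) k 0),
        e.1 = unitCochain C k ∧
        e'.1 = unitCochain (OrbitCat k G C) k ∧
        ι 0 ⟨HH.mk e, he⟩ = HH.mk e') ∧
      (∀ (m n : ℕ) (ψ : cocycles C k m) (φ : cocycles C k n)
          (hψ : HH.mk ψ ∈ (HHRep C k G m).invariants)
          (hφ : HH.mk φ ∈ (HHRep C k G n).invariants)
          (ψ' : cocycles (OrbitCat k G C) k m)
          (φ' : cocycles (OrbitCat k G C) k n),
        ι m ⟨HH.mk ψ, hψ⟩ = HH.mk ψ' →
        ι n ⟨HH.mk φ, hφ⟩ = HH.mk φ' →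
        ∃ (c : cocycles C k (n + m))
          (hc : HH.mk c ∈ (HHRep C k G (n + m)).invariants)
          (c' : cocycles (OrbitCat k G C) k (n + m)),
          c.1 = cup ψ.1 φ.1 ∧
          c'.1 = cup ψ'.1 φ'.1 ∧
          ι (n + m) ⟨HH.mk c, hc⟩ = HH.mk c') ∧
      -- for every transversal, the cohomology of `C/G` is the product of its factors at the
      -- conjugacy classes of `G`; the image of `ι` is the factor at the trivial class, and `ρ` is
      -- the projection to that factor
      (∀ (u : OrbitCat k G C → C)
          (hu : ∀ α, orb k G (u α) = α),
        IsGrading (orbitDegree u hu) ∧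
        ∀ n : ℕ, ∃ e : HH (OrbitCat k G C) k n ≃ₗ[k]
            (∀ D : ConjClasses G,
              HHClass (orbitDegree u hu) D n),
          (∀ (D : ConjClasses G)
              (ξ : HHClass (orbitDegree u hu) D n),
            e (HHClass.toHH (orbitDegree u hu) D n ξ) D = ξ ∧
            ∀ D' : ConjClasses G, D' ≠ D →
              e (HHClass.toHH (orbitDegree u hu) D n ξ) D' =
                0) ∧
          LinearMap.range (ι n) = LinearMap.range
            (HHClass.toHH (orbitDegree u hu)
              (ConjClasses.mk (1 : G)) n) ∧
          ∀ ξ : HH (OrbitCat k G C) k n,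
            ι n (ρ n ξ) = HHClass.toHH (orbitDegree u hu)
              (ConjClasses.mk (1 : G)) n (e ξ (ConjClasses.mk (1 : G)))) := by
  have hG := Rep.finite_and_card_ne_zero_of_exactFunctor hexact
  have := hG.1
  have := Fintype.ofFinite G
  have := Fintype.ofFinite (ConjClasses G)
  have : Invertible (Fintype.card G : k) :=
    invertibleOfNonzero (Nat.card_eq_fintype_card (α := G) ▸ hG.2)
  -- An arbitrary transversal serves to define `ι`. It is unrelated to the transversals `u` of the
  -- last assertion, which is why the lemmas on induction after restriction allow two of them.
  have hu₀ : ∀ α : OrbitCat k G C, orb k G (exists_orb_eq k α).choose = α :=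
    fun α => (exists_orb_eq k α).choose_spec
  obtain ⟨ι, hι⟩ : ∃ ι : ∀ n, (HHRep C k G n).invariants →ₗ[k] HH (OrbitCat k G C) k n,
      ∀ n, ι n = induceHH _ hu₀ n ∘ₗ Submodule.subtype _ := ⟨_, fun _ => rfl⟩
  have hι' : ∀ n ξ (h : ξ ∈ (HHRep C k G n).invariants), ι n ⟨ξ, h⟩ = induceHH _ hu₀ n ξ :=
    fun n ξ h => LinearMap.congr_fun (hι n) ⟨ξ, h⟩
  have hρι : ∀ n ξ, restrictHH C k G n (ι n ξ) = ξ := fun n ξ => by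
    rw [hι' n ξ.1 ξ.2, restrictHH_induceHH]
  refine ⟨ι, restrictHH C k G, fun n ξ => HH.exists_invariant_cocycle ξ.2, fun n φ hφ => ?_,
    fun n => Function.LeftInverse.injective (hρι n), fun n => LinearMap.ext (hρι n),
    ?_, ?_, fun u hu => ?_⟩
  · have h := isInduced_induceCochain _ hu₀ hφ
    exact ⟨⟨_, induceCochain_mem_cocycles _ hu₀ hφ φ.2⟩, h, fun χ' hχ' => hχ'.unique h,
      HH.mk_mem_invariants hφ, (hι' n _ _).trans (induceHH_mk _ hu₀ φ hφ)⟩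
  · exact ⟨⟨_, unitCochain_mem_cocycles⟩, HH.mk_mem_invariants unitCochain_mem_invariants,
      ⟨_, unitCochain_mem_cocycles⟩, rfl, rfl, (hι' 0 _ _).trans
      (induceHH_mk_of_isInduced _ hu₀ unitCochain_mem_invariants isInduced_unitCochain)⟩
  · intro m n ψ φ hψ hφ ψ' φ' hψ' hφ'
    rw [hι'] at hψ' hφ'
    have h := induceHH_cup _ hu₀ hψ hφ hψ' hφ'
    exact ⟨⟨cup ψ.1 φ.1, cup_mem_cocycles ψ.2 φ.2⟩, h.1,
      ⟨cup ψ'.1 φ'.1, cup_mem_cocycles ψ'.2 φ'.2⟩, rfl, rfl, (hι' _ _ _).trans h.2⟩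
  · have hgr := isGrading_orbitDegree (k := k) u hu
    refine ⟨hgr, fun n => ⟨hgr.equivHHClass n, hgr.equivHHClass_toHH, ?_, fun ξ => ?_⟩⟩
    · rw [hι]
      exact range_induceHH u _ hu hu₀ n
    · exact (hι' n _ _).trans (induceHH_restrictHH u _ hu hu₀ ξ)
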